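/- Let $K\subset\mathbb{C}$ be a (closed, non-degenerate) convex polygon with corners $\omega_1,\dots,\omega_k$, $k\ge 3$. Let $f:K\to\mathbb{C}$ be analytic in the interior $\operatorname{Int}K$ and analytic on the interior of each side (that is, near each point of a side other than its end points, $f$ is the restriction to $K$ of a function analytic in a neighbourhood of that point). Suppose that there is $\delta>0$ such that for each $i$ the function $f$ can be continued analytically to a disc $\{|z-\omega_i|<R_i\}$, $R_i>0$, slit along the exterior bisector at $\omega_i$ (the ray from $\omega_i$ opposite to the bisector of the interior angle of $K$ at $\omega_i$), and that the function $f$ so continued satisfies $$f(z)-f(\omega_i)=O(|z-\omega_i|^{\delta}),\qquad z\to\omega_i,$$ in this slit disc. Then there exist rational functions $r_n$ of degree at most $n$ without poles in $K$, $1\le n<\infty$, and a constant $C>0$ such that $$\|f-r_n\|_K=O(e^{-C\sqrt n}),$$ and such that for every compact set $E\subset\operatorname{Int}K$ there is $c=c(E)>0$, independent of $n$, with $$\limsup_{n\to\infty}\|f-r_n\|_E\,e^{cn}=0 .$$ Here a rational function of degree at most $n$ is a quotient of two polynomials of degree at most $n$, and $\|\cdot\|_S$ is the supremum norm over $S$.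 -/

import Mathlib

open Set Filter Topology Asymptotics
open scoped ENNReal

noncomputable section

/-- `ω 0, …, ω (k-1)` are the corners, in counterclockwise order (indices modulo `k`), of a
convex polygon: `k ≥ 3`, and each corner other than the two end points `ω i`, `ω (i+1)` of a side
lies strictly to the left of the directed line from `ω i` to `ω (i+1)`.  (All interior angles
are then in `(0, π)`.)  The polygon itself is the closed region `polygonRegion ω`. -/
def IsConvexPolygon {k : ℕ} [NeZero k] (ω : Fin k → ℂ) : Prop :=
  3 ≤ k ∧ ∀ i j : Fin k, j ≠ i → j ≠ i + 1 →
    0 < (starRingEnd ℂ (ω (i + 1) - ω i) * (ω j - ω i)).im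

/-- The closed region bounded by the polygon: the convex hull of its corners. -/
def polygonRegion {k : ℕ} (ω : Fin k → ℂ) : Set ℂ :=
  convexHull ℝ (range ω)

/-- The interior of the `i`-th side: the side without its two end points. -/
def openSide {k : ℕ} [NeZero k] (ω : Fin k → ℂ) (i : Fin k) : Set ℂ :=
  openSegment ℝ (ω i) (ω (i + 1))

/-- A vector that points from the corner `ω i` along the bisector of the interior angle there:
the sum of the unit vectors along the two sides that meet at `ω i`. -/
def interiorBisectorDir {k : ℕ} [NeZero k] (ω : Fin k → ℂ) (i : Fin k) : ℂ :=
  (ω (i + 1) - ω i) / (‖ω (i + 1) - ω i‖ : ℂ) + (ω (i - 1) - ω i) / (‖ω (i - 1) - ω i‖ : ℂ)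

/-- The exterior bisector at the corner `ω i`: the closed ray that starts at `ω i` in the
direction opposite to the interior bisector. -/
def exteriorBisector {k : ℕ} [NeZero k] (ω : Fin k → ℂ) (i : Fin k) : Set ℂ :=
  {z | ∃ t : ℝ, 0 ≤ t ∧ z = ω i - (t : ℂ) * interiorBisectorDir ω i}

/-- The open disc of radius `R` about `ω i`, slit along the exterior bisector. -/
def slitDisc {k : ℕ} [NeZero k] (ω : Fin k → ℂ) (i : Fin k) (R : ℝ) : Set ℂ :=
  Metric.ball (ω i) R \ exteriorBisector ω i

/-- On the set `S`, the function `r` is a rational function of degree at most `n` without poles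
in `S`. -/
def IsRationalOn (n : ℕ) (S : Set ℂ) (r : ℂ → ℂ) : Prop :=
  ∃ p q : Polynomial ℂ, p.natDegree ≤ n ∧ q.natDegree ≤ n ∧
    ∀ z ∈ S, q.eval z ≠ 0 ∧ r z = p.eval z / q.eval z

/-- The supremum norm of `g` over `S`, with values in `[0, ∞]`. -/
def supNorm (S : Set ℂ) (g : ℂ → ℂ) : ℝ≥0∞ :=
  ⨆ z ∈ S, ‖g z‖ₑ

end

/-! Subtracting a Lagrange interpolation polynomial makes `f` vanish to a positive order at every
corner. Cauchy's formula then writes a nonzero constant times `f`, in the interior, as a sum over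
the sides of Cauchy integrals, so one side can be treated at a time.

Across a side `f` continues to a thin triangle outside the polygon
(`exists_extension_thinTriangle`). Its height can be linear in the distance to the end points
because the slit discs contain half discs about the side directions. Deforming the path to the outer
legs of the triangle leaves integrals over segments that start at a corner `a` and leave, at a
positive angle, the half plane bounded by the side. There the density is `O(t ^ δ)`.

For such an integral (`hasRootExpApprox_cauchyIntegral_ray`) take a Blaschke product `W` of the half
plane. The integral of `φ / (ζ - z)` equals a rational function whose poles are those of `W`, plus
`W z` times the integral of `φ / (W (ζ - z))`. In the half plane `|W| ≤ 1`, and on the segment `|1 /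
W| ≤ 1`. About `√n` zeros at each of about `√n` dyadic distances from `a` give `t ^ δ / |W| ≤ ρ ^ √n
* t ^ (δ / 2)`: scales above `2 ^ (-√n)` are damped by `1 / W`, and below it `t ^ (δ / 2)` is itself
that small. Since `|ζ - z|` is at least a multiple of `t`, the error is `O(ρ ^ √n)`. A further zero
of multiplicity `n` at a fixed point makes `W` geometrically small on compact subsets of the
interior, and the degree stays `O(n)`.

Continuity carries the estimate to the boundary, and reindexing turns degree `O(n)` into degree at
most `n`. -/

noncomputable section

/-! ### Arithmetic of rational functions of bounded degree -/

open Polynomial in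
theorem IsRationalOn.add {m n : ℕ} {S : Set ℂ} {r s : ℂ → ℂ} (hr : IsRationalOn m S r)
    (hs : IsRationalOn n S s) : IsRationalOn (m + n) S (fun z => r z + s z) := by
  obtain ⟨p, q, hp, hq, h⟩ := hr
  obtain ⟨p', q', hp', hq', h'⟩ := hs
  refine ⟨p * q' + q * p', q * q', ?_, ?_, fun z hz => ?_⟩
  · refine natDegree_add_le_of_degree_le ?_ ?_
    · exact natDegree_mul_le.trans (by omega)
    · exact natDegree_mul_le.trans (by omega)
  · exact natDegree_mul_le.trans (by omega)
  · obtain ⟨h1, h2⟩ := h z hz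
    obtain ⟨h3, h4⟩ := h' z hz
    refine ⟨by simp [h1, h3], ?_⟩
    simp [h2, h4, div_add_div _ _ h1 h3]

open Polynomial in
theorem IsRationalOn.const_mul {n : ℕ} {S : Set ℂ} {r : ℂ → ℂ} (hr : IsRationalOn n S r) (c : ℂ) :
    IsRationalOn n S (fun z => c * r z) := by
  obtain ⟨p, q, hp, hq, h⟩ := hr
  refine ⟨C c * p, q, (natDegree_C_mul_le c p).trans hp, hq, fun z hz => ?_⟩
  obtain ⟨h1, h2⟩ := h z hz
  refine ⟨h1, ?_⟩
  simp [h2, mul_div_assoc]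

theorem IsRationalOn.mono {m n : ℕ} {S : Set ℂ} {r : ℂ → ℂ} (hr : IsRationalOn m S r)
    (h : m ≤ n) : IsRationalOn n S r := by
  obtain ⟨p, q, hp, hq, h'⟩ := hr
  exact ⟨p, q, hp.trans h, hq.trans h, h'⟩

theorem isRationalOn_polynomial (n : ℕ) (S : Set ℂ) (p : Polynomial ℂ) (hp : p.natDegree ≤ n) :
    IsRationalOn n S (fun z => p.eval z) :=
  ⟨p, 1, hp, by simp, fun z _ => by simp⟩

/-! ### The linear space of functions approximable at root-exponential rate -/

/-- `h` is approximated on `interior K` by rational functions `r n` without poles in `K`, of degree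
`O(n)`, with error `O(exp (-C √n))`, and geometrically fast on compact subsets of `interior K`. -/
def HasRootExpApprox (K : Set ℂ) (h : ℂ → ℂ) : Prop :=
  ∃ D : ℕ, ∃ r : ℕ → ℂ → ℂ, (∀ n, IsRationalOn (D * (n + 1)) K (r n)) ∧
    (∃ C : ℝ, 0 < C ∧ ∃ M : ℝ, ∀ n : ℕ, ∀ z ∈ interior K,
      ‖h z - r n z‖ ≤ M * Real.exp (-C * √n)) ∧
    ∀ E : Set ℂ, IsCompact E → E ⊆ interior K → ∃ c : ℝ, 0 < c ∧ ∃ M : ℝ, ∀ n : ℕ, ∀ z ∈ E,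
      ‖h z - r n z‖ ≤ M * Real.exp (-c * n)

namespace HasRootExpApprox

variable {K : Set ℂ} {h h₁ h₂ : ℂ → ℂ}

theorem congr (H : HasRootExpApprox K h₁) (e : EqOn h₁ h₂ (interior K)) :
    HasRootExpApprox K h₂ := by
  obtain ⟨D, r, hr, ⟨C, hC, M, hM⟩, hE⟩ := H
  refine ⟨D, r, hr, ⟨C, hC, M, fun n z hz => by rw [← e hz]; exact hM n z hz⟩, fun E h1 h2 => ?_⟩
  obtain ⟨c, hc, M', hM'⟩ := hE E h1 h2
  exact ⟨c, hc, M', fun n z hz => by rw [← e (h2 hz)]; exact hM' n z hz⟩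

theorem exp_bound_add {x y : ℂ} {A B c d t : ℝ} (ht : 0 ≤ t)
    (hx : ‖x‖ ≤ A * Real.exp (-c * t)) (hy : ‖y‖ ≤ B * Real.exp (-d * t)) :
    ‖x + y‖ ≤ (|A| + |B|) * Real.exp (-(min c d) * t) := by
  have h1 : Real.exp (-c * t) ≤ Real.exp (-(min c d) * t) := by
    apply Real.exp_le_exp.2
    nlinarith [min_le_left c d]
  have h2 : Real.exp (-d * t) ≤ Real.exp (-(min c d) * t) := by
    apply Real.exp_le_exp.2
    nlinarith [min_le_right c d]
  have h3 : ‖x‖ ≤ |A| * Real.exp (-(min c d) * t) :=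
    hx.trans ((mul_le_mul_of_nonneg_right (le_abs_self A) (Real.exp_pos _).le).trans
      (mul_le_mul_of_nonneg_left h1 (abs_nonneg A)))
  have h4 : ‖y‖ ≤ |B| * Real.exp (-(min c d) * t) :=
    hy.trans ((mul_le_mul_of_nonneg_right (le_abs_self B) (Real.exp_pos _).le).trans
      (mul_le_mul_of_nonneg_left h2 (abs_nonneg B)))
  rw [add_mul]
  exact (norm_add_le _ _).trans (add_le_add h3 h4)

theorem add (H₁ : HasRootExpApprox K h₁) (H₂ : HasRootExpApprox K h₂) :
    HasRootExpApprox K (fun z => h₁ z + h₂ z) := by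
  obtain ⟨D, r, hr, ⟨C, hC, M, hM⟩, hE⟩ := H₁
  obtain ⟨D', r', hr', ⟨C', hC', M', hM'⟩, hE'⟩ := H₂
  refine ⟨D + D', fun n z => r n z + r' n z, fun n => ?_,
    ⟨min C C', lt_min hC hC', |M| + |M'|, fun n z hz => ?_⟩, fun E h1 h2 => ?_⟩
  · rw [add_mul]
    exact (hr n).add (hr' n)
  · rw [add_sub_add_comm]
    exact exp_bound_add (Real.sqrt_nonneg _) (hM n z hz) (hM' n z hz)
  · obtain ⟨c, hc, B, hB⟩ := hE E h1 h2
    obtain ⟨c', hc', B', hB'⟩ := hE' E h1 h2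
    refine ⟨min c c', lt_min hc hc', |B| + |B'|, fun n z hz => ?_⟩
    rw [add_sub_add_comm]
    exact exp_bound_add (Nat.cast_nonneg _) (hB n z hz) (hB' n z hz)

theorem const_mul (H : HasRootExpApprox K h) (a : ℂ) : HasRootExpApprox K (fun z => a * h z) := by
  obtain ⟨D, r, hr, ⟨C, hC, M, hM⟩, hE⟩ := H
  refine ⟨D, fun n z => a * r n z, fun n => (hr n).const_mul a,
    ⟨C, hC, ‖a‖ * M, fun n z hz => ?_⟩, fun E h1 h2 => ?_⟩
  · rw [← mul_sub, norm_mul, mul_assoc]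
    exact mul_le_mul_of_nonneg_left (hM n z hz) (norm_nonneg a)
  · obtain ⟨c, hc, B, hB⟩ := hE E h1 h2
    refine ⟨c, hc, ‖a‖ * B, fun n z hz => ?_⟩
    rw [← mul_sub, norm_mul, mul_assoc]
    exact mul_le_mul_of_nonneg_left (hB n z hz) (norm_nonneg a)

theorem polynomial (K : Set ℂ) (p : Polynomial ℂ) : HasRootExpApprox K (fun z => p.eval z) :=
  ⟨p.natDegree, fun _ z => p.eval z,
    fun n => isRationalOn_polynomial _ _ _ (Nat.le_mul_of_pos_right _ n.succ_pos),
    ⟨1, one_pos, 0, by simp⟩, fun _ _ _ => ⟨1, one_pos, 0, by simp⟩⟩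

theorem sum {ι : Type*} (s : Finset ι) (h : ι → ℂ → ℂ)
    (H : ∀ i ∈ s, HasRootExpApprox K (h i)) : HasRootExpApprox K (fun z => ∑ i ∈ s, h i z) := by
  classical
  induction s using Finset.induction_on with
  | empty => simpa using polynomial K 0
  | insert i s hi ih =>
    simp only [Finset.sum_insert hi]
    exact (H i (by simp)).add (ih fun j hj => H j (by simp [hj]))

end HasRootExpApprox

/-! ### Blaschke factors of a half plane -/

/-- The closed half plane through `a` with inner normal `ν`. -/
def halfPlane (a ν : ℂ) : Set ℂ := {z | 0 ≤ (starRingEnd ℂ ν * (z - a)).re}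

/-- The Blaschke factor of `halfPlane a ν` with zero `a + b ν` and pole `a - b ν`. -/
def blaschke (a ν : ℂ) (b : ℝ) (z : ℂ) : ℂ := (z - a - b * ν) / (z - a + b * ν)

/-- Decides whether the zero or the pole of a Blaschke factor is nearer. The sign of the right side
gives `|W| ≤ 1` in the half plane and `|1 / W| ≤ 1` on a ray leaving it. -/
theorem norm_sq_add_smul_sub (x ν : ℂ) (b : ℝ) :
    ‖x + b * ν‖ ^ 2 - ‖x - b * ν‖ ^ 2 = 4 * b * (starRingEnd ℂ ν * x).re := by
  rw [← Complex.normSq_eq_norm_sq, ← Complex.normSq_eq_norm_sq, Complex.normSq_apply,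
    Complex.normSq_apply]
  simp
  ring

theorem norm_blaschke_le_one {a ν z : ℂ} {b : ℝ} (hb : 0 ≤ b) (hz : z ∈ halfPlane a ν) :
    ‖blaschke a ν b z‖ ≤ 1 := by
  have h := norm_sq_add_smul_sub (z - a) ν b
  have hz' : 0 ≤ (starRingEnd ℂ ν * (z - a)).re := hz
  rw [blaschke, norm_div]
  refine div_le_one_of_le₀ (abs_le_of_sq_le_sq' ?_ (norm_nonneg _)).2 (norm_nonneg _)
  nlinarith [mul_nonneg hb hz']

theorem norm_blaschke_lt_one {a ν z : ℂ} {b : ℝ} (hb : 0 < b)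
    (hz : 0 < (starRingEnd ℂ ν * (z - a)).re) : ‖blaschke a ν b z‖ < 1 := by
  have h := norm_sq_add_smul_sub (z - a) ν b
  have h1 := mul_pos hb hz
  have h2 : ‖z - a - b * ν‖ < ‖z - a + b * ν‖ := by
    apply lt_of_pow_lt_pow_left₀ 2 (norm_nonneg _)
    linarith
  rw [blaschke, norm_div]
  exact (div_lt_one ((norm_nonneg _).trans_lt h2)).2 h2

theorem sub_add_ne_zero_of_mem_halfPlane {a ν z : ℂ} {b : ℝ} (hν : ν ≠ 0) (hb : 0 < b)
    (hz : z ∈ halfPlane a ν) : z - a + b * ν ≠ 0 := by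
  intro h
  have h0 : z - a = -(b * ν) := by linear_combination h
  have hz' : 0 ≤ (starRingEnd ℂ ν * (z - a)).re := hz
  rw [h0] at hz'
  have h2 : (starRingEnd ℂ ν * (-(b * ν))).re = -(b * Complex.normSq ν) := by
    simp [Complex.normSq_apply]
    ring
  have h3 := mul_pos hb (Complex.normSq_pos.2 hν)
  linarith

theorem continuousOn_blaschke {a ν : ℂ} {b : ℝ} (hν : ν ≠ 0) (hb : 0 < b) :
    ContinuousOn (blaschke a ν b) (halfPlane a ν) := by
  unfold blaschke
  exact ContinuousOn.div (by fun_prop) (by fun_prop)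
    fun z hz => sub_add_ne_zero_of_mem_halfPlane hν hb hz

/-! ### Splitting a Blaschke product off the Cauchy kernel -/

open Polynomial in
/-- `W` is a rational function of degree at most `N` that can be split off the Cauchy kernel of the
segment from `a` to `a + v` at the cost of a rational function of degree at most `N`. -/
def SplitsCauchyKernel (a v : ℂ) (S : Set ℂ) (N : ℕ) (W : ℂ → ℂ) : Prop :=
  ContinuousOn (fun t : ℝ => (W (a + t * v))⁻¹) (Icc 0 1) ∧
  ∃ P Q : ℂ[X], P.natDegree ≤ N ∧ Q.natDegree ≤ N ∧
    (∀ z ∈ S, Q.eval z ≠ 0 ∧ W z = P.eval z / Q.eval z) ∧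
    ∀ φ : ℝ → ℂ, ContinuousOn φ (Icc 0 1) → ∃ p : ℂ[X], p.natDegree ≤ N ∧
      ∀ z ∈ S, (∀ t ∈ Icc (0 : ℝ) 1, a + t * v - z ≠ 0) →
        ∫ t in (0 : ℝ)..1, φ t / (a + t * v - z) = p.eval z / Q.eval z +
          W z * ∫ t in (0 : ℝ)..1, φ t * (W (a + t * v))⁻¹ / (a + t * v - z)

namespace SplitsCauchyKernel

variable {a v : ℂ} {S : Set ℂ}

theorem one : SplitsCauchyKernel a v S 0 (fun _ => 1) :=
  ⟨continuousOn_const, 1, 1, by simp, by simp, by simp, fun φ _ => ⟨0, by simp, by simp⟩⟩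

open Polynomial in
-- Split with `W₁` for the density `φ`, then with `W₂` for the density `φ / W₁`. The second rational
-- term gets multiplied by `W₁ = P₁ / Q₁`, so `Q₁ * Q₂` is a common denominator.
theorem mul {N₁ N₂ : ℕ} {W₁ W₂ : ℂ → ℂ} (H₁ : SplitsCauchyKernel a v S N₁ W₁)
    (H₂ : SplitsCauchyKernel a v S N₂ W₂) :
    SplitsCauchyKernel a v S (N₁ + N₂) (fun z => W₁ z * W₂ z) := by
  obtain ⟨c₁, P₁, Q₁, hP₁, hQ₁, e₁, i₁⟩ := H₁
  obtain ⟨c₂, P₂, Q₂, hP₂, hQ₂, e₂, i₂⟩ := H₂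
  refine ⟨by simp only [mul_inv]; exact c₁.mul c₂, P₁ * P₂, Q₁ * Q₂,
    natDegree_mul_le.trans (by omega), natDegree_mul_le.trans (by omega), fun z hz => ?_,
    fun φ hφ => ?_⟩
  · obtain ⟨q₁, f₁⟩ := e₁ z hz
    obtain ⟨q₂, f₂⟩ := e₂ z hz
    exact ⟨by simp [q₁, q₂], by simp [f₁, f₂, div_mul_div_comm]⟩
  · obtain ⟨p₁, d₁, j₁⟩ := i₁ φ hφ
    obtain ⟨p₂, d₂, j₂⟩ := i₂ (fun t => φ t * (W₁ (a + t * v))⁻¹) (hφ.mul c₁)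
    refine ⟨p₁ * Q₂ + P₁ * p₂, natDegree_add_le_of_degree_le (natDegree_mul_le.trans (by omega))
      (natDegree_mul_le.trans (by omega)), fun z hz hne => ?_⟩
    obtain ⟨q₁, f₁⟩ := e₁ z hz
    obtain ⟨q₂, f₂⟩ := e₂ z hz
    simp only [mul_inv, ← mul_assoc]
    rw [j₁ z hz hne, j₂ z hz hne, mul_add, ← add_assoc, ← mul_assoc, f₁]
    congr 1
    simp only [eval_add, eval_mul]
    field_simp

theorem pow {N : ℕ} {W : ℂ → ℂ} (H : SplitsCauchyKernel a v S N W) (m : ℕ) :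
    SplitsCauchyKernel a v S (m * N) (fun z => W z ^ m) := by
  induction m with
  | zero => simpa using one
  | succ m ih => simpa only [pow_succ, add_mul, one_mul] using ih.mul H

theorem prod_range {N : ℕ} {W : ℕ → ℂ → ℂ} (H : ∀ j, SplitsCauchyKernel a v S N (W j)) (m : ℕ) :
    SplitsCauchyKernel a v S (m * N) (fun z => ∏ j ∈ Finset.range m, W j z) := by
  induction m with
  | zero => simpa using one
  | succ m ih => simpa only [Finset.prod_range_succ, add_mul, one_mul] using ih.mul (H m)

end SplitsCauchyKernel

section Ray

variable {a ν v : ℂ}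

theorem ray_sub_ne_zero (hv : (starRingEnd ℂ ν * v).re < 0) {b t : ℝ} (hb : 0 < b) (ht : 0 ≤ t) :
    (t : ℂ) * v - b * ν ≠ 0 := by
  have hν : ν ≠ 0 := by
    rintro rfl
    simp at hv
  intro h
  have h0 : (t : ℂ) * v = b * ν := by linear_combination h
  have h1 : (starRingEnd ℂ ν * (t * v)).re = t * (starRingEnd ℂ ν * v).re := by
    simp
    ring
  have h2 : (starRingEnd ℂ ν * (b * ν)).re = b * Complex.normSq ν := by
    simp [Complex.normSq_apply]
    ring
  rw [h0, h2] at h1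
  have h3 := mul_pos hb (Complex.normSq_pos.2 hν)
  nlinarith

open Polynomial in
-- With `ζ` on the ray, `1 / (ζ - z) = 2bν / ((ζ - a - bν)(z - a + bν)) + W z / (W ζ (ζ - z))`. The
-- first term separates `ζ` from `z`, so integrating it gives a constant over `z - a + bν`.
theorem splitsCauchyKernel_blaschke (hv : (starRingEnd ℂ ν * v).re < 0) {b : ℝ} (hb : 0 < b) :
    SplitsCauchyKernel a v (halfPlane a ν) 1 (blaschke a ν b) := by
  have hν : ν ≠ 0 := by
    rintro rfl
    simp at hv
  have hray : ∀ t ∈ Icc (0 : ℝ) 1, a + t * v - a - b * ν ≠ 0 := fun t ht => by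
    rw [add_sub_cancel_left]
    exact ray_sub_ne_zero hv hb ht.1
  have hinv : ContinuousOn (fun t : ℝ => (blaschke a ν b (a + t * v))⁻¹) (Icc 0 1) := by
    simp only [blaschke, inv_div]
    exact ContinuousOn.div (by fun_prop) (by fun_prop) hray
  refine ⟨hinv, X - C (a + b * ν), X - C (a - b * ν), natDegree_X_sub_C_le _,
    natDegree_X_sub_C_le _, fun z hz => ?_,
    fun φ hφ => ?_⟩
  · have := sub_add_ne_zero_of_mem_halfPlane hν hb hz
    refine ⟨by simpa [sub_add] using this, ?_⟩
    simp [blaschke, sub_add, sub_sub]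
  · refine ⟨C (∫ t in (0 : ℝ)..1, φ t * (2 * b * ν / (a + t * v - a - b * ν))), by simp,
      fun z hz hne => ?_⟩
    have hz' := sub_add_ne_zero_of_mem_halfPlane hν hb hz
    rw [eval_C, show eval z (X - C (a - b * ν)) = z - a + b * ν by simp [sub_add],
      ← intervalIntegral.integral_div, ← intervalIntegral.integral_const_mul,
      ← intervalIntegral.integral_add]
    · refine intervalIntegral.integral_congr fun t ht => ?_
      rw [uIcc_of_le zero_le_one] at ht
      have h1 := hne t ht
      have h2 := hray t ht
      simp only [blaschke, inv_div]
      rw [eq_comm, div_eq_mul_inv (φ t) (a + t * v - z)]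
      have : φ t * (2 * b * ν / (a + t * v - a - b * ν)) / (z - a + b * ν) +
        (z - a - b * ν) / (z - a + b * ν) *
          (φ t * ((a + t * v - a + b * ν) / (a + t * v - a - b * ν)) / (a + t * v - z)) =
        φ t * ((2 * b * ν * (a + t * v - z) + (z - a - b * ν) * (a + t * v - a + b * ν)) /
          ((a + t * v - a - b * ν) * (z - a + b * ν) * (a + t * v - z))) := by
        field_simp
      rw [this]
      congr 1
      rw [div_eq_iff (mul_ne_zero (mul_ne_zero h2 hz') h1)]
      field_simp
      ring
    · refine (ContinuousOn.div_const (hφ.mul (ContinuousOn.div (by fun_prop) (by fun_prop) hray))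
        _).intervalIntegrable_of_Icc zero_le_one
    · refine ContinuousOn.intervalIntegrable_of_Icc zero_le_one ?_
      exact continuousOn_const.mul ((hφ.mul hinv).div (by fun_prop) hne)

end Ray

/-! ### Clustered zeros and the Cauchy integral over a ray leaving a half plane -/

section Ray

variable {a ν v : ℂ}

theorem ray_re (t : ℝ) :
    (starRingEnd ℂ ν * (t * v)).re = t * (starRingEnd ℂ ν * v).re := by
  simp
  ring

theorem norm_inv_blaschke_ray_le_one (hv : (starRingEnd ℂ ν * v).re < 0) {b t : ℝ} (hb : 0 < b)
    (ht : 0 ≤ t) : ‖(blaschke a ν b (a + t * v))⁻¹‖ ≤ 1 := by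
  have h := norm_sq_add_smul_sub (t * v) ν b
  rw [ray_re] at h
  rw [blaschke, inv_div, norm_div, add_sub_cancel_left]
  refine div_le_one_of_le₀ (abs_le_of_sq_le_sq' ?_ (norm_nonneg _)).2 (norm_nonneg _)
  nlinarith [mul_nonneg hb.le ht, mul_nonneg (mul_nonneg hb.le ht) (neg_pos.2 hv).le]

/-- On the ray the factor depends only on `t / b`, so its inverse is uniformly below `1` while `b`
is comparable to `t`. -/
theorem exists_norm_inv_blaschke_ray_le (hv : (starRingEnd ℂ ν * v).re < 0) :
    ∃ q : ℝ, 0 ≤ q ∧ q < 1 ∧ ∀ b t : ℝ, 0 < t → t ≤ b → b ≤ 2 * t →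
      ‖(blaschke a ν b (a + t * v))⁻¹‖ ≤ q := by
  set κ := -(starRingEnd ℂ ν * v).re with hκ
  have hκ0 : 0 < κ := by linarith
  have hν : 0 < ‖ν‖ := by
    rw [norm_pos_iff]
    rintro rfl
    simp at hv
  set L := ‖v‖ + ‖ν‖ with hL
  have hL0 : 0 < L := by positivity
  set η := 2 * κ / L ^ 2 with hη
  have hη0 : 0 < η := by positivity
  refine ⟨√(1 - η), Real.sqrt_nonneg _, ?_, fun b t ht htb hbt => ?_⟩
  · rw [Real.sqrt_lt' one_pos]
    linarith
  have hb : 0 < b := ht.trans_le htb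
  have h := norm_sq_add_smul_sub (t * v) ν b
  rw [ray_re] at h
  have h0 := ray_sub_ne_zero hv hb ht.le
  have h1 : ‖(t : ℂ) * v - b * ν‖ ≤ b * L := by
    refine (norm_sub_le _ _).trans ?_
    rw [norm_mul, norm_mul, Complex.norm_real, Complex.norm_real, Real.norm_of_nonneg ht.le,
      Real.norm_of_nonneg hb.le, hL, mul_add]
    gcongr
  have h2 : η * ‖(t : ℂ) * v - b * ν‖ ^ 2 ≤ 4 * b * t * κ := by
    have h3 : ‖(t : ℂ) * v - b * ν‖ ^ 2 ≤ (b * L) ^ 2 := by gcongr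
    have h4 : η * (b * L) ^ 2 = 2 * κ * b ^ 2 := by
      rw [hη]
      field_simp
    have h5 : 2 * κ * b ^ 2 ≤ 4 * b * t * κ := by
      have := mul_le_mul_of_nonneg_left hbt (mul_nonneg hκ0.le hb.le)
      nlinarith
    exact (mul_le_mul_of_nonneg_left h3 hη0.le).trans (h4.le.trans h5)
  rw [blaschke, inv_div, norm_div, add_sub_cancel_left]
  apply Real.le_sqrt_of_sq_le
  rw [div_pow, div_le_iff₀ (by positivity)]
  nlinarith

/-- Compares components along `ν`. The kernel thus costs at most a factor of order `1 / t`,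
uniformly in `z`, however close `z` is to `a`. -/
theorem mul_le_norm_ray_sub (hv : (starRingEnd ℂ ν * v).re < 0) {z : ℂ} (hz : z ∈ halfPlane a ν)
    (t : ℝ) :
    t * (-(starRingEnd ℂ ν * v).re / ‖ν‖) ≤ ‖a + t * v - z‖ := by
  have hν : 0 < ‖ν‖ := by
    rw [norm_pos_iff]
    rintro rfl
    simp at hv
  rw [← mul_div_assoc, div_le_iff₀ hν]
  have h1 := Complex.abs_re_le_norm (starRingEnd ℂ ν * (a + t * v - z))
  rw [norm_mul, RCLike.norm_conj, mul_comm ‖ν‖] at h1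
  refine le_trans ?_ ((neg_le_abs _).trans h1)
  have h2 : (starRingEnd ℂ ν * (a + t * v - z)).re =
      t * (starRingEnd ℂ ν * v).re - (starRingEnd ℂ ν * (z - a)).re := by
    rw [← ray_re, ← Complex.sub_re]
    congr 1
    ring
  have hz' : 0 ≤ (starRingEnd ℂ ν * (z - a)).re := hz
  rw [h2]
  linarith

/-- Blaschke product with `n` zeros at `a + ν` and `√n` zeros at each of `a + 2⁻ʲ ν`, `j ≤ √n`. -/
def clusteredBlaschke (a ν : ℂ) (n : ℕ) (z : ℂ) : ℂ :=
  blaschke a ν 1 z ^ n * ∏ j ∈ Finset.range (n.sqrt + 1), blaschke a ν ((1 / 2) ^ j) z ^ n.sqrt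

theorem splitsCauchyKernel_clusteredBlaschke (hv : (starRingEnd ℂ ν * v).re < 0) (n : ℕ) :
    SplitsCauchyKernel a v (halfPlane a ν) (n * 1 + (n.sqrt + 1) * (n.sqrt * 1))
      (clusteredBlaschke a ν n) :=
  ((splitsCauchyKernel_blaschke hv one_pos).pow n).mul
    (SplitsCauchyKernel.prod_range (fun j => (splitsCauchyKernel_blaschke hv
      (pow_pos one_half_pos j)).pow n.sqrt) (n.sqrt + 1))

theorem norm_prod_le_one {ι : Type*} (s : Finset ι) (g : ι → ℂ) (h : ∀ i ∈ s, ‖g i‖ ≤ 1) :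
    ‖∏ i ∈ s, g i‖ ≤ 1 := by
  rw [norm_prod]
  exact Finset.prod_le_one (fun _ _ => norm_nonneg _) h

theorem norm_clusteredBlaschke_le {z : ℂ} (hz : z ∈ halfPlane a ν) (n : ℕ) :
    ‖clusteredBlaschke a ν n z‖ ≤ ‖blaschke a ν 1 z‖ ^ n := by
  rw [clusteredBlaschke, norm_mul, norm_pow]
  refine mul_le_of_le_one_right (by positivity) (norm_prod_le_one _ _ fun j _ => ?_)
  rw [norm_pow]
  exact pow_le_one₀ (norm_nonneg _) (norm_blaschke_le_one (by positivity) hz)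

/-- All inverse factors are at most `1` on the ray, so everything but the zeros at one chosen scale
may be dropped. -/
theorem norm_inv_clusteredBlaschke_ray_le (hv : (starRingEnd ℂ ν * v).re < 0) {t : ℝ}
    (ht : 0 ≤ t) (n : ℕ) {j : ℕ} (hj : j ≤ n.sqrt) :
    ‖(clusteredBlaschke a ν n (a + t * v))⁻¹‖ ≤
      ‖(blaschke a ν ((1 / 2) ^ j) (a + t * v))⁻¹‖ ^ n.sqrt := by
  have hle : ∀ b : ℝ, 0 < b → ∀ m : ℕ, ‖((blaschke a ν b (a + t * v)) ^ m)⁻¹‖ ≤ 1 := fun b hb m => by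
    rw [← inv_pow, norm_pow]
    exact pow_le_one₀ (norm_nonneg _) (norm_inv_blaschke_ray_le_one hv hb ht)
  rw [clusteredBlaschke, mul_inv, norm_mul, ← Finset.prod_inv_distrib,
    ← Finset.mul_prod_erase _ _ (Finset.mem_range.2 (Nat.lt_succ_of_le hj)), norm_mul,
    ← norm_pow, inv_pow]
  refine (mul_le_of_le_one_left (by positivity) (hle _ one_pos _)).trans ?_
  exact mul_le_of_le_one_right (norm_nonneg _)
    (norm_prod_le_one _ _ fun i _ => by simpa using hle _ (pow_pos one_half_pos i) n.sqrt)

/-- On the ray, `t ^ δ / W` is small: for `t` not too small because of `W`, else because of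
`t ^ δ`. -/
theorem exists_rpow_mul_norm_inv_clusteredBlaschke_le (hv : (starRingEnd ℂ ν * v).re < 0)
    {δ : ℝ} (hδ : 0 < δ) :
    ∃ ρ : ℝ, 0 < ρ ∧ ρ < 1 ∧ ∀ (n : ℕ) (t : ℝ), 0 < t → t ≤ 1 →
      t ^ δ * ‖(clusteredBlaschke a ν n (a + t * v))⁻¹‖ ≤ ρ ^ n.sqrt * t ^ (δ / 2) := by
  obtain ⟨q, hq0, hq1, hq⟩ := exists_norm_inv_blaschke_ray_le (a := a) hv
  have hp : (0 : ℝ) < (1 / 2 : ℝ) ^ (δ / 2) := by positivity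
  refine ⟨max q ((1 / 2 : ℝ) ^ (δ / 2)), lt_max_of_lt_right hp,
    max_lt hq1 (Real.rpow_lt_one (by norm_num) (by norm_num) (by linarith)), fun n t ht ht1 => ?_⟩
  -- Half of the exponent produces the decay; the other half is kept to make `t ^ (δ / 2) / t`
  -- integrable.
  have hs : t ^ δ = t ^ (δ / 2) * t ^ (δ / 2) := by
    rw [← Real.rpow_add ht]
    ring_nf
  -- The dyadic scale `b = 2 ^ (-j)` satisfies `t ≤ b ≤ 2 t`.
  obtain ⟨j, hj1, hj2⟩ := exists_nat_pow_near_of_lt_one ht ht1 one_half_pos one_half_lt_one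
  by_cases hjn : j ≤ n.sqrt
  · have h1 : ‖(clusteredBlaschke a ν n (a + t * v))⁻¹‖ ≤
        max q ((1 / 2 : ℝ) ^ (δ / 2)) ^ n.sqrt := by
      refine (norm_inv_clusteredBlaschke_ray_le hv ht.le n hjn).trans ?_
      refine pow_le_pow_left₀ (norm_nonneg _) ((hq _ t ht hj2 ?_).trans (le_max_left _ _)) _
      rw [pow_succ] at hj1
      linarith
    have h2 : t ^ δ ≤ t ^ (δ / 2) :=
      Real.rpow_le_rpow_of_exponent_ge ht ht1 (by linarith)
    rw [mul_comm]
    exact mul_le_mul h1 h2 (by positivity) (by positivity)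
  · have h1 : ‖(clusteredBlaschke a ν n (a + t * v))⁻¹‖ ≤ 1 :=
      (norm_inv_clusteredBlaschke_ray_le hv ht.le n (Nat.zero_le _)).trans
        (pow_le_one₀ (norm_nonneg _) (norm_inv_blaschke_ray_le_one hv (by simp) ht.le))
    have h2 : t ^ (δ / 2) ≤ max q ((1 / 2 : ℝ) ^ (δ / 2)) ^ n.sqrt := by
      have h3 : t ≤ (1 / 2 : ℝ) ^ n.sqrt :=
        hj2.trans (pow_le_pow_of_le_one (by norm_num) (by norm_num) (by omega))
      calc t ^ (δ / 2) ≤ ((1 / 2 : ℝ) ^ n.sqrt) ^ (δ / 2) :=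
            Real.rpow_le_rpow ht.le h3 (by linarith)
        _ = ((1 / 2 : ℝ) ^ (δ / 2)) ^ n.sqrt := by
            rw [← Real.rpow_natCast, ← Real.rpow_natCast, ← Real.rpow_mul (by norm_num),
              ← Real.rpow_mul (by norm_num), mul_comm]
        _ ≤ _ := pow_le_pow_left₀ hp.le (le_max_right _ _) _
    rw [hs]
    calc t ^ (δ / 2) * t ^ (δ / 2) * ‖(clusteredBlaschke a ν n (a + t * v))⁻¹‖
        ≤ t ^ (δ / 2) * t ^ (δ / 2) * 1 := by gcongr
      _ = t ^ (δ / 2) * t ^ (δ / 2) := mul_one _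
      _ ≤ _ := by gcongr

theorem re_pos_of_mem_interior_halfPlane {z : ℂ} (hν : ν ≠ 0)
    (hz : z ∈ interior (halfPlane a ν)) : 0 < (starRingEnd ℂ ν * (z - a)).re := by
  have hc : Tendsto (fun ε : ℝ => z - ε * ν) (𝓝[>] 0) (𝓝 z) := by
    have : Continuous (fun ε : ℝ => z - ε * ν) := by fun_prop
    simpa using (this.tendsto 0).mono_left nhdsWithin_le_nhds
  obtain ⟨ε, h1, h2⟩ := ((hc.eventually (mem_interior_iff_mem_nhds.1 hz)).and
    self_mem_nhdsWithin).exists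
  have h3 : 0 ≤ (starRingEnd ℂ ν * (z - ε * ν - a)).re := h1
  have h4 : (starRingEnd ℂ ν * (z - ε * ν - a)).re =
      (starRingEnd ℂ ν * (z - a)).re - ε * Complex.normSq ν := by
    simp [Complex.normSq_apply]
    ring
  have h5 := mul_pos (show (0 : ℝ) < ε from h2) (Complex.normSq_pos.2 hν)
  linarith

/-- The integer square root loses at most `1` against `√n`, which costs the factor `ρ⁻¹`. -/
theorem pow_sqrt_le_exp {ρ : ℝ} (h0 : 0 < ρ) (h1 : ρ < 1) (n : ℕ) :
    ρ ^ n.sqrt ≤ ρ⁻¹ * Real.exp (-(-Real.log ρ) * √n) := by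
  have h2 : √(n : ℝ) ≤ n.sqrt + 1 := by
    rw [Real.sqrt_le_left (by positivity)]
    have := (Nat.lt_succ_sqrt' n).le
    exact_mod_cast this
  rw [neg_neg, ← Real.rpow_def_of_pos h0, ← div_eq_inv_mul, le_div_iff₀ h0, ← pow_succ,
    ← Real.rpow_natCast]
  refine Real.rpow_le_rpow_of_exponent_ge h0 h1.le ?_
  push_cast
  exact h2

/-- The Cauchy integral over a segment that leaves a half plane containing `K` at a point where the
density vanishes to a positive order. -/
theorem hasRootExpApprox_cauchyIntegral_ray {K : Set ℂ} (hK : K ⊆ halfPlane a ν)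
    (hv : (starRingEnd ℂ ν * v).re < 0) {φ : ℝ → ℂ} (hφ : ContinuousOn φ (Icc 0 1)) {δ M : ℝ}
    (hδ : 0 < δ) (hM : ∀ t ∈ Ioc (0 : ℝ) 1, ‖φ t‖ ≤ M * t ^ δ) :
    HasRootExpApprox K (fun z => ∫ t in (0 : ℝ)..1, φ t / (a + t * v - z)) := by
  have hν : ν ≠ 0 := by
    rintro rfl
    simp at hv
  have hκ : 0 < -(starRingEnd ℂ ν * v).re / ‖ν‖ := div_pos (by linarith) (norm_pos_iff.2 hν)
  set κ := -(starRingEnd ℂ ν * v).re / ‖ν‖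
  have hM0 : 0 ≤ M := by simpa using (norm_nonneg _).trans (hM 1 (by simp))
  have hint : ∀ z ∈ interior K, 0 < (starRingEnd ℂ ν * (z - a)).re := fun z hz =>
    re_pos_of_mem_interior_halfPlane hν (interior_mono hK hz)
  have hne : ∀ z ∈ interior K, ∀ t ∈ Icc (0 : ℝ) 1, a + t * v - z ≠ 0 := fun z hz t ht h => by
    have h1 := hint z hz
    rw [show z - a = t * v by linear_combination -h, ray_re] at h1
    nlinarith [ht.1]
  choose hW P Q hP hQ hPQ hsplit using
    fun n => splitsCauchyKernel_clusteredBlaschke (a := a) hv n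
  choose p hp hpe using fun n => hsplit n φ hφ
  obtain ⟨ρ, hρ0, hρ1, hρ⟩ := exists_rpow_mul_norm_inv_clusteredBlaschke_le (a := a) hv hδ
  have hii : IntervalIntegrable (fun t : ℝ => t ^ (δ / 2 - 1)) MeasureTheory.volume 0 1 :=
    intervalIntegral.intervalIntegrable_rpow' (by linarith)
  set B := ∫ t in (0 : ℝ)..1, t ^ (δ / 2 - 1)
  have hB : 0 ≤ B := intervalIntegral.integral_nonneg zero_le_one fun t ht =>
    Real.rpow_nonneg ht.1 _
  have hbound : ∀ (n : ℕ), ∀ z ∈ interior K,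
      ‖∫ t in (0 : ℝ)..1, φ t * (clusteredBlaschke a ν n (a + t * v))⁻¹ / (a + t * v - z)‖ ≤
        M / κ * ρ ^ n.sqrt * B := fun n z hz => by
    rw [← intervalIntegral.integral_const_mul]
    refine intervalIntegral.norm_integral_le_of_norm_le zero_le_one
      (Eventually.of_forall fun t ht => ?_) (hii.const_mul _)
    have h1 := mul_le_norm_ray_sub hv (hK (interior_subset hz)) t
    have h2 : 0 < t * κ := mul_pos ht.1 hκ
    rw [norm_div, norm_mul, div_le_iff₀ (h2.trans_le h1)]
    calc ‖φ t‖ * ‖(clusteredBlaschke a ν n (a + t * v))⁻¹‖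
        ≤ M * t ^ δ * ‖(clusteredBlaschke a ν n (a + t * v))⁻¹‖ := by
          gcongr
          exact hM t ht
      _ = M * (t ^ δ * ‖(clusteredBlaschke a ν n (a + t * v))⁻¹‖) := by ring
      _ ≤ M * (ρ ^ n.sqrt * t ^ (δ / 2)) := by
          exact mul_le_mul_of_nonneg_left (hρ n t ht.1 ht.2) hM0
      _ = M / κ * ρ ^ n.sqrt * t ^ (δ / 2 - 1) * (t * κ) := by
          rw [Real.rpow_sub_one ht.1.ne']
          have := ht.1.ne'
          field_simp
      _ ≤ _ := by
          have := ht.1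
          gcongr
  have herr : ∀ (n : ℕ), ∀ z ∈ interior K,
      ‖(∫ t in (0 : ℝ)..1, φ t / (a + t * v - z)) - (p n).eval z / (Q n).eval z‖ ≤
        M / κ * B * ρ ^ n.sqrt * ‖blaschke a ν 1 z‖ ^ n := fun n z hz => by
    rw [hpe n z (hK (interior_subset hz)) (hne z hz), add_sub_cancel_left, norm_mul, mul_comm]
    refine (mul_le_mul (hbound n z hz) (norm_clusteredBlaschke_le (hK (interior_subset hz)) n)
      (norm_nonneg _) (by positivity)).trans (le_of_eq ?_)
    ring
  have hC : 0 ≤ M / κ * B := by positivity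
  refine ⟨3, fun n z => (p n).eval z / (Q n).eval z, fun n => ?_, ?_, fun E hE hEK => ?_⟩
  · have hdeg : n * 1 + (n.sqrt + 1) * (n.sqrt * 1) ≤ 3 * (n + 1) := by
      have := Nat.sqrt_le' n
      have := Nat.sqrt_le_self n
      nlinarith
    exact ⟨p n, Q n, (hp n).trans hdeg, (hQ n).trans hdeg,
      fun z hz => ⟨(hPQ n z (hK hz)).1, rfl⟩⟩
  · refine ⟨-Real.log ρ, neg_pos.2 (Real.log_neg hρ0 hρ1), M / κ * B * ρ⁻¹, fun n z hz => ?_⟩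
    refine (herr n z hz).trans ?_
    rw [mul_assoc _ ρ⁻¹]
    refine (mul_le_of_le_one_right (by positivity) (pow_le_one₀ (norm_nonneg _)
      (norm_blaschke_le_one zero_le_one (hK (interior_subset hz))))).trans ?_
    exact mul_le_mul_of_nonneg_left (pow_sqrt_le_exp hρ0 hρ1 n) hC
  · obtain ⟨q, hq0, hq1, hq⟩ : ∃ q : ℝ, 0 < q ∧ q < 1 ∧ ∀ z ∈ E, ‖blaschke a ν 1 z‖ ≤ q := by
      rcases E.eq_empty_or_nonempty with rfl | hne
      · exact ⟨1 / 2, by norm_num, by norm_num, by simp⟩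
      · obtain ⟨z₀, hz₀, hmax⟩ := hE.exists_isMaxOn hne
          (((continuousOn_blaschke hν one_pos).mono
            (hEK.trans (interior_subset.trans hK))).norm)
        refine ⟨max (1 / 2) ‖blaschke a ν 1 z₀‖, by positivity, max_lt (by norm_num)
          (norm_blaschke_lt_one one_pos (hint z₀ (hEK hz₀))), fun z hz =>
          (hmax hz).trans (le_max_right _ _)⟩
    refine ⟨-Real.log q, neg_pos.2 (Real.log_neg hq0 hq1), M / κ * B, fun n z hz => ?_⟩
    refine (herr n z (hEK hz)).trans ?_
    rw [neg_neg, ← Real.rpow_def_of_pos hq0, Real.rpow_natCast]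
    exact mul_le_mul (mul_le_of_le_one_right hC (pow_le_one₀ hρ0.le hρ1.le))
      (pow_le_pow_left₀ (norm_nonneg _) (hq z hz) n) (by positivity) hC

end Ray

/-! ### Cauchy's theorem in a convex set, up to the boundary -/

/-- The integral of `h` along the segment from `w` to `w'`. -/
def segmentIntegral (h : ℂ → ℂ) (w w' : ℂ) : ℂ :=
  ∫ t in (0 : ℝ)..1, h (w + t * (w' - w)) * (w' - w)

theorem add_mul_sub_mem {T : Set ℂ} (hT : Convex ℝ T) {w w' : ℂ} (hw : w ∈ T) (hw' : w' ∈ T)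
    {t : ℝ} (ht : t ∈ Icc (0 : ℝ) 1) : w + t * (w' - w) ∈ T := by
  simpa using hT.add_smul_sub_mem hw hw' ht

/-- On the boundary `h` is only continuous, so the triangle is contracted towards the interior point
`a` by a factor `s < 1`. The contracted side lies in the interior, where `h` has a primitive `G`;
after division by `s`, continuity in `s` gives the case `s = 1`. -/
theorem segmentIntegral_add {T : Set ℂ} (hT : Convex ℝ T) {h : ℂ → ℂ} (hc : ContinuousOn h T)
    (hd : DifferentiableOn ℂ h (interior T)) {a : ℂ} (ha : a ∈ interior T) {w w' : ℂ} (hw : w ∈ T)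
    (hw' : w' ∈ T) :
    segmentIntegral h a w + segmentIntegral h w w' = segmentIntegral h a w' := by
  obtain ⟨G, hG⟩ := hT.interior.exists_forall_hasDerivWithinAt hd
  -- Clamping both parameters to `[0, 1]` makes the integrand continuous on the whole plane, as the
  -- theorem on parametric integrals requires.
  set c : ℝ → ℝ := fun s => max 0 (min s 1) with hcdef
  have hcI : ∀ s, c s ∈ Icc (0 : ℝ) 1 := fun s => ⟨le_max_left _ _, by simp [c]⟩
  have hcid : ∀ s ∈ Icc (0 : ℝ) 1, c s = s := fun s hs => by simp [c, hs.1, hs.2]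
  have hcc : Continuous c := by fun_prop
  set J : ℂ → ℂ → ℝ → ℂ := fun x y s =>
    ∫ t in (0 : ℝ)..1, h (a + c s * (x + c t * (y - x) - a)) * (y - x)
  have hJc : ∀ x ∈ T, ∀ y ∈ T, Continuous (J x y) := fun x hx y hy => by
    refine intervalIntegral.continuous_parametric_intervalIntegral_of_continuous' ?_ _ _
    refine Continuous.mul ?_ continuous_const
    refine hc.comp_continuous (by fun_prop) fun p => ?_
    exact add_mul_sub_mem hT (interior_subset ha) (add_mul_sub_mem hT hx hy (hcI _)) (hcI _)
  have hJ1 : ∀ x y, J x y 1 = segmentIntegral h x y := fun x y => by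
    refine intervalIntegral.integral_congr fun t ht => ?_
    rw [uIcc_of_le zero_le_one] at ht
    simp [hcid t ht, hcid 1 (by simp)]
  have hJs : ∀ x ∈ T, ∀ y ∈ T, ∀ s ∈ Ioo (0 : ℝ) 1,
      (s : ℂ) * J x y s = G (a + s * (y - a)) - G (a + s * (x - a)) := fun x hx y hy s hs => by
    have hmem : ∀ t ∈ Icc (0 : ℝ) 1, a + s * (x + t * (y - x) - a) ∈ interior T := fun t ht => by
      have := hT.combo_interior_self_mem_interior ha (add_mul_sub_mem hT hx hy ht)
        (sub_pos.2 hs.2) hs.1.le (by ring)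
      convert this using 1
      simp
      ring
    have h1 : ∀ t ∈ uIcc (0 : ℝ) 1, HasDerivAt (fun t : ℝ => G (a + s * (x + t * (y - x) - a)))
        (h (a + s * (x + t * (y - x) - a)) * (s * (y - x))) t := fun t ht => by
      rw [uIcc_of_le zero_le_one] at ht
      have h2 := (hG _ (hmem t ht)).hasDerivAt (isOpen_interior.mem_nhds (hmem t ht))
      have h3 : HasDerivAt (fun t : ℝ => a + s * (x + t * (y - x) - a)) (s * (y - x)) t := by
        have h4 : HasDerivAt (fun t : ℝ => (t : ℂ)) 1 t := Complex.ofRealCLM.hasDerivAt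
        simpa using ((((h4.mul_const (y - x)).const_add x).sub_const a).const_mul
          (s : ℂ)).const_add a
      exact h2.comp t h3
    have h5 := intervalIntegral.integral_eq_sub_of_hasDerivAt h1
      (ContinuousOn.intervalIntegrable_of_Icc zero_le_one (ContinuousOn.mul
        (hc.comp (by fun_prop) fun t ht => interior_subset (hmem t ht)) continuousOn_const))
    simp only [J]
    rw [← intervalIntegral.integral_const_mul]
    convert h5 using 1
    · refine intervalIntegral.integral_congr fun t ht => ?_
      rw [uIcc_of_le zero_le_one] at ht
      simp only [hcid t ht, hcid s ⟨hs.1.le, hs.2.le⟩]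
      ring
    · simp
  have haT := interior_subset ha
  have heq : EqOn (fun s => J a w s + J w w' s) (J a w') (Icc 0 1) := by
    rw [← closure_Ioo zero_ne_one]
    refine EqOn.closure (fun s hs => ?_) ((hJc a haT w hw).add (hJc w hw w' hw')) (hJc a haT w' hw')
    have hs0 : (s : ℂ) ≠ 0 := by exact_mod_cast hs.1.ne'
    apply mul_left_cancel₀ hs0
    simp only [mul_add]
    rw [hJs a haT w hw s hs, hJs w hw w' hw' s hs, hJs a haT w' hw' s hs]
    ring
  simpa [hJ1] using heq (show (1 : ℝ) ∈ Icc (0 : ℝ) 1 by simp)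

/-- A function that is continuous on a convex set and holomorphic in its interior has a primitive in
the sense of segment integrals. -/
theorem exists_segmentIntegral_eq_sub {T : Set ℂ} (hT : Convex ℝ T) (hne : (interior T).Nonempty)
    {h : ℂ → ℂ} (hc : ContinuousOn h T) (hd : DifferentiableOn ℂ h (interior T)) :
    ∃ H : ℂ → ℂ, ∀ w ∈ T, ∀ w' ∈ T, segmentIntegral h w w' = H w' - H w := by
  obtain ⟨a, ha⟩ := hne
  exact ⟨segmentIntegral h a, fun w hw w' hw' =>
    eq_sub_of_add_eq' (segmentIntegral_add hT hc hd ha hw hw')⟩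

theorem segmentIntegral_congr {g h : ℂ → ℂ} {w w' : ℂ}
    (e : ∀ t ∈ Icc (0 : ℝ) 1, g (w + t * (w' - w)) = h (w + t * (w' - w))) :
    segmentIntegral g w w' = segmentIntegral h w w' := by
  refine intervalIntegral.integral_congr fun t ht => ?_
  rw [uIcc_of_le zero_le_one] at ht
  simp only [e t ht]

/-! ### Geometry of a convex polygon -/

/-- The determinant of two vectors of the plane. -/
def cross (x y : ℂ) : ℝ := (starRingEnd ℂ x * y).im

theorem cross_eq (x y : ℂ) : cross x y = x.re * y.im - x.im * y.re := by
  simp [cross]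
  ring

theorem re_conj_I_mul (D x : ℂ) : (starRingEnd ℂ (Complex.I * D) * x).re = cross D x := by
  simp [cross_eq]

theorem mem_halfPlane_I_mul {a D z : ℂ} :
    z ∈ halfPlane a (Complex.I * D) ↔ 0 ≤ cross D (z - a) := by
  rw [halfPlane, mem_ofPred_eq, re_conj_I_mul]

theorem exists_weights_of_mem_polygonRegion {k : ℕ} {ω : Fin k → ℂ} {z : ℂ}
    (hz : z ∈ polygonRegion ω) :
    ∃ w : Fin k → ℝ, (∀ i, 0 ≤ w i) ∧ ∑ i, w i = 1 ∧ ∑ i, w i • ω i = z := by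
  classical
  have hconv : Convex ℝ ((fun w : Fin k → ℝ => ∑ i, w i • ω i) '' stdSimplex ℝ (Fin k)) := by
    refine (convex_stdSimplex ℝ (Fin k)).is_linear_image ⟨fun x y => ?_, fun c x => ?_⟩
    · simp [add_mul, Finset.sum_add_distrib]
    · simp [Finset.mul_sum, mul_assoc]
  have hsub : range ω ⊆ (fun w : Fin k → ℝ => ∑ i, w i • ω i) '' stdSimplex ℝ (Fin k) := by
    rintro _ ⟨i, rfl⟩
    refine ⟨Pi.single i 1, single_mem_stdSimplex ℝ i, ?_⟩
    simp [Pi.single_apply]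
  obtain ⟨w, hw, rfl⟩ := convexHull_min hsub hconv hz
  exact ⟨w, hw.1, hw.2, rfl⟩

theorem isCompact_polygonRegion {k : ℕ} (ω : Fin k → ℂ) : IsCompact (polygonRegion ω) :=
  (finite_range ω).isCompact_convexHull (𝕜 := ℝ)

theorem convex_polygonRegion {k : ℕ} (ω : Fin k → ℂ) : Convex ℝ (polygonRegion ω) :=
  convex_convexHull ℝ _

theorem mem_polygonRegion {k : ℕ} (ω : Fin k → ℂ) (i : Fin k) : ω i ∈ polygonRegion ω :=
  subset_convexHull ℝ _ (mem_range_self i)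

namespace IsConvexPolygon

variable {k : ℕ} [NeZero k] {ω : Fin k → ℂ}

theorem one_ne_zero (hω : IsConvexPolygon ω) : (1 : Fin k) ≠ 0 := by
  have := hω.1
  intro h
  have := congrArg Fin.val h
  rw [Fin.val_one', Fin.val_zero, Nat.mod_eq_of_lt (by omega)] at this
  omega

theorem one_add_one_ne_zero (hω : IsConvexPolygon ω) : (1 + 1 : Fin k) ≠ 0 := by
  have := hω.1
  intro h
  have := congrArg Fin.val h
  rw [Fin.val_add, Fin.val_one', Fin.val_zero, Nat.mod_eq_of_lt (a := 1) (by omega),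
    Nat.mod_eq_of_lt (by omega)] at this
  omega

theorem add_one_ne (hω : IsConvexPolygon ω) (i : Fin k) : i + 1 ≠ i := by
  simpa using hω.one_ne_zero

theorem sub_one_ne (hω : IsConvexPolygon ω) (i : Fin k) : i - 1 ≠ i := by
  simpa [sub_eq_iff_eq_add] using hω.one_ne_zero

theorem sub_one_ne_add_one (hω : IsConvexPolygon ω) (i : Fin k) : i - 1 ≠ i + 1 := by
  rw [Ne, sub_eq_iff_eq_add, add_assoc]
  simpa using hω.one_add_one_ne_zero

theorem cross_pos (hω : IsConvexPolygon ω) {i j : Fin k} (h : j ≠ i) (h' : j ≠ i + 1) :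
    0 < cross (ω (i + 1) - ω i) (ω j - ω i) :=
  hω.2 i j h h'

theorem cross_adjacent_pos (hω : IsConvexPolygon ω) (i : Fin k) :
    0 < cross (ω (i + 1) - ω i) (ω (i - 1) - ω i) :=
  hω.cross_pos (hω.sub_one_ne i) (hω.sub_one_ne_add_one i)

theorem sub_ne_zero (hω : IsConvexPolygon ω) (i : Fin k) : ω (i + 1) - ω i ≠ 0 := by
  intro h
  have := hω.cross_adjacent_pos i
  simp [cross_eq, h] at this

theorem injective (hω : IsConvexPolygon ω) : Function.Injective ω := by
  intro i j h
  by_contra hne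
  by_cases hj : j = i + 1
  · apply hω.sub_ne_zero i
    rw [← hj, h, sub_self]
  · have := hω.cross_pos (Ne.symm hne) hj
    simp [cross_eq, h] at this

theorem cross_nonneg (hω : IsConvexPolygon ω) (i : Fin k) {z : ℂ} (hz : z ∈ polygonRegion ω) :
    0 ≤ cross (ω (i + 1) - ω i) (z - ω i) := by
  obtain ⟨w, hw0, hw1, rfl⟩ := exists_weights_of_mem_polygonRegion hz
  have h1 : cross (ω (i + 1) - ω i) (∑ j, w j • ω j - ω i) =
      ∑ j, w j * cross (ω (i + 1) - ω i) (ω j - ω i) := by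
    have h2 : ∑ j, w j • ω j - ω i = ∑ j, (w j : ℂ) * (ω j - ω i) := by
      simp only [mul_sub, Finset.sum_sub_distrib, ← Finset.sum_mul]
      have : (∑ j, (w j : ℂ)) = 1 := by exact_mod_cast hw1
      simp [this]
    rw [h2, cross, Finset.mul_sum, Complex.im_sum]
    refine Finset.sum_congr rfl fun j _ => ?_
    simp [cross_eq]
    ring
  rw [h1]
  refine Finset.sum_nonneg fun j _ => mul_nonneg (hw0 j) ?_
  by_cases h2 : j = i
  · simp [h2, cross_eq]
  by_cases h3 : j = i + 1
  · rw [h3, cross_eq]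
    ring_nf
    rfl
  · exact (hω.cross_pos h2 h3).le

theorem subset_halfPlane (hω : IsConvexPolygon ω) (i : Fin k) :
    polygonRegion ω ⊆ halfPlane (ω i) (Complex.I * (ω (i + 1) - ω i)) := fun _ hz =>
  mem_halfPlane_I_mul.2 (hω.cross_nonneg i hz)

theorem subset_halfPlane' (hω : IsConvexPolygon ω) (i : Fin k) :
    polygonRegion ω ⊆ halfPlane (ω (i + 1)) (Complex.I * (ω (i + 1) - ω i)) := fun z hz => by
  have h := hω.cross_nonneg i hz
  rw [mem_halfPlane_I_mul]
  refine h.trans_eq ?_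
  simp only [cross_eq, Complex.sub_re, Complex.sub_im]
  ring

theorem cross_pos_of_mem_interior (hω : IsConvexPolygon ω) (i : Fin k) {z : ℂ}
    (hz : z ∈ interior (polygonRegion ω)) : 0 < cross (ω (i + 1) - ω i) (z - ω i) := by
  rw [← re_conj_I_mul]
  exact re_pos_of_mem_interior_halfPlane (mul_ne_zero Complex.I_ne_zero (hω.sub_ne_zero i))
    (interior_mono (hω.subset_halfPlane i) hz)

/-- The triangle of a corner and its two neighbours suffices: its barycentric coordinates are ratios
of determinants, and their positivity is an open condition. -/
theorem interior_nonempty (hω : IsConvexPolygon ω) : (interior (polygonRegion ω)).Nonempty := by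
  set A := ω (0 + 1) - ω 0
  set B := ω (0 - 1) - ω 0
  have hAB : 0 < cross A B := hω.cross_adjacent_pos 0
  set d := cross A B with hd
  have hopen : IsOpen {z : ℂ | 0 < cross (z - ω 0) B ∧ 0 < cross A (z - ω 0) ∧
      cross (z - ω 0) B + cross A (z - ω 0) < d} := by
    have h1 : Continuous fun z : ℂ => cross (z - ω 0) B := by
      simp only [cross_eq]
      fun_prop
    have h2 : Continuous fun z : ℂ => cross A (z - ω 0) := by
      simp only [cross_eq]
      fun_prop
    exact (isOpen_lt continuous_const h1).inter ((isOpen_lt continuous_const h2).inter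
      (isOpen_lt (h1.add h2) continuous_const))
  refine ⟨ω 0 + (1 / 3 : ℝ) * A + (1 / 3 : ℝ) * B, interior_maximal ?_ hopen ?_⟩
  · rintro z ⟨h1, h2, h3⟩
    set x := cross (z - ω 0) B / d with hx
    set y := cross A (z - ω 0) / d with hy
    have hx0 : 0 < x := by positivity
    have hy0 : 0 < y := by positivity
    have hxy : x + y < 1 := by
      rw [hx, hy, ← add_div, div_lt_one hAB]
      exact h3
    have hz : z = (1 - x - y) • ω 0 + x • ω (0 + 1) + y • ω (0 - 1) := by
      have h4 : (z - ω 0) = x * A + y * B := by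
        apply Complex.ext
        · simp [hx, hy]
          field_simp
          simp [hd, cross_eq]
          ring
        · simp [hx, hy]
          field_simp
          simp [hd, cross_eq]
          ring
      have h5 : z = ω 0 + (x * A + y * B) := by rw [← h4]; ring
      rw [h5]
      simp [A, B]
      ring
    rw [hz]
    have := (convex_polygonRegion ω).sum_mem (t := Finset.univ)
      (w := ![1 - x - y, x, y]) (z := ![ω 0, ω (0 + 1), ω (0 - 1)]) ?_ ?_ ?_
    · simpa [Fin.sum_univ_three] using this
    · intro i _
      fin_cases i
      · simp; linarith
      · simp [hx0.le]
      · simp [hy0.le]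
    · simp [Fin.sum_univ_three]
      ring
    · intro i _
      fin_cases i <;> simp [mem_polygonRegion]
  · have h1 : ω 0 + (1 / 3 : ℝ) * A + (1 / 3 : ℝ) * B - ω 0 = (1 / 3 : ℝ) * (A + B) := by ring
    rw [mem_ofPred_eq, h1]
    have h2 : cross ((1 / 3 : ℝ) * (A + B)) B = d / 3 := by
      simp [hd, cross_eq]
      ring
    have h3 : cross A ((1 / 3 : ℝ) * (A + B)) = d / 3 := by
      simp [hd, cross_eq]
      ring
    rw [h2, h3]
    refine ⟨by positivity, by positivity, by linarith⟩

theorem closure_interior (hω : IsConvexPolygon ω) :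
    closure (interior (polygonRegion ω)) = polygonRegion ω := by
  rw [(convex_polygonRegion ω).closure_interior_eq_closure_of_nonempty_interior
    hω.interior_nonempty, (isCompact_polygonRegion ω).isClosed.closure_eq]

/-- The kernel of a nonzero real functional on the plane is a line. -/
theorem cross_eq_zero_of_apply_eq_zero {l : ℂ →L[ℝ] ℝ} (hl : l ≠ 0) {x y : ℂ} (hx : l x = 0)
    (hy : l y = 0) : cross x y = 0 := by
  have hform : ∀ u : ℂ, l u = u.re * l 1 + u.im * l Complex.I := fun u => by
    conv_lhs => rw [← Complex.re_add_im u]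
    rw [map_add, show (u.re : ℂ) = u.re • (1 : ℂ) by simp,
      show (u.im : ℂ) * Complex.I = u.im • Complex.I by simp, map_smul, map_smul]
    simp
  rw [hform] at hx hy
  rw [cross_eq]
  by_contra hne
  have h1 : (x.re * y.im - x.im * y.re) * l 1 = 0 := by linear_combination y.im * hx - x.im * hy
  have h2 : (x.re * y.im - x.im * y.re) * l Complex.I = 0 := by
    linear_combination x.re * hy - y.re * hx
  apply hl
  ext u
  rw [hform, (mul_eq_zero.1 h1).resolve_left hne, (mul_eq_zero.1 h2).resolve_left hne]
  simp

/-- If `b` were not a neighbour of `a`, Cramer's rule would make `ω b - ω a` a combination of the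
two edges at `a` with positive coefficients. Both edges have `l ≤ 0`, so `l` would vanish on an edge
and on `ω b - ω a`, which are not parallel. -/
theorem eq_or_eq_of_isMax (hω : IsConvexPolygon ω) {l : ℂ →L[ℝ] ℝ} (hl : l ≠ 0) {a b : Fin k}
    (ha : ∀ j, l (ω j) ≤ l (ω a)) (hab : l (ω b) = l (ω a)) (hne : b ≠ a) :
    b = a + 1 ∨ b = a - 1 := by
  by_contra! hcon
  have h1 : 0 < cross (ω (a + 1) - ω a) (ω b - ω a) := hω.cross_pos hne hcon.1
  have h2 : 0 < cross (ω b - ω a) (ω (a - 1) - ω a) := by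
    have := hω.cross_pos (i := a - 1) hcon.2 (by simpa using hne)
    rw [sub_add_cancel] at this
    refine this.trans_eq ?_
    simp only [cross_eq, Complex.sub_re, Complex.sub_im]
    ring
  have h3 : (cross (ω (a + 1) - ω a) (ω (a - 1) - ω a)) • (ω b - ω a) =
      cross (ω b - ω a) (ω (a - 1) - ω a) • (ω (a + 1) - ω a) +
        cross (ω (a + 1) - ω a) (ω b - ω a) • (ω (a - 1) - ω a) := by
    apply Complex.ext
    · simp [cross_eq]
      ring
    · simp [cross_eq]
      ring
  have h4 := congrArg l h3
  have h0 : l (ω b - ω a) = 0 := by rw [map_sub, hab, sub_self]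
  rw [map_add, map_smul, map_smul, map_smul, h0, smul_zero] at h4
  have h5 : l (ω (a + 1) - ω a) ≤ 0 := by
    rw [map_sub]
    linarith [ha (a + 1)]
  have h6 : l (ω (a - 1) - ω a) ≤ 0 := by
    rw [map_sub]
    linarith [ha (a - 1)]
  simp only [smul_eq_mul] at h4
  have h7 : l (ω (a + 1) - ω a) = 0 := by
    by_contra hne'
    have := mul_neg_of_pos_of_neg h2 (lt_of_le_of_ne h5 hne')
    have := mul_nonpos_of_nonneg_of_nonpos h1.le h6
    linarith
  exact h1.ne' (cross_eq_zero_of_apply_eq_zero hl h7 h0)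

/-- A point of a convex polygon is an interior point, a corner, or inside a side. -/
theorem mem_interior_or (hω : IsConvexPolygon ω) {z : ℂ} (hz : z ∈ polygonRegion ω) :
    z ∈ interior (polygonRegion ω) ∨ (∃ i, z ∈ openSide ω i) ∨ ∃ i, z = ω i := by
  classical
  by_cases hzi : z ∈ interior (polygonRegion ω)
  · exact Or.inl hzi
  right
  -- A supporting functional at `z`: every corner with positive weight in `z` maximises `l`, which
  -- leaves a single corner or two adjacent ones.
  obtain ⟨l, hl⟩ := geometric_hahn_banach_open_point (convex_polygonRegion ω).interior
    isOpen_interior hzi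
  have hl0 : l ≠ 0 := by
    rintro rfl
    obtain ⟨a, ha⟩ := hω.interior_nonempty
    simpa using hl a ha
  have hle : ∀ j, l (ω j) ≤ l z := fun j => by
    have h1 : ω j ∈ closure (interior (polygonRegion ω)) := by
      rw [hω.closure_interior]
      exact mem_polygonRegion ω j
    exact closure_minimal (fun a ha => (hl a ha).le)
      (isClosed_le l.continuous continuous_const) h1
  obtain ⟨w, hw0, hw1, hwz⟩ := exists_weights_of_mem_polygonRegion hz
  have hmax : ∀ j, w j ≠ 0 → l (ω j) = l z := by
    have h1 : ∑ j, w j * (l z - l (ω j)) = 0 := by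
      simp only [mul_sub, Finset.sum_sub_distrib, ← Finset.sum_mul, hw1, one_mul]
      conv_lhs => rw [← hwz, map_sum]
      simp only [map_smul, smul_eq_mul, sub_self]
    have h2 := (Finset.sum_eq_zero_iff_of_nonneg fun j _ =>
      mul_nonneg (hw0 j) (sub_nonneg.2 (hle j))).1 h1
    intro j hj
    have := (mul_eq_zero.1 (h2 j (Finset.mem_univ j))).resolve_left hj
    linarith
  obtain ⟨a, -, ha⟩ := Finset.exists_ne_zero_of_sum_ne_zero (hw1.trans_ne _root_.one_ne_zero)
  by_cases hall : ∀ b, b ≠ a → w b = 0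
  · right
    refine ⟨a, ?_⟩
    rw [Finset.sum_eq_single a (fun b _ hb => hall b hb) (by simp)] at hw1
    rw [← hwz, Finset.sum_eq_single a (fun b _ hb => by simp [hall b hb]) (by simp), hw1, one_smul]
  · left
    push Not at hall
    obtain ⟨b, hba, hb⟩ := hall
    obtain ⟨i, hi, hi'⟩ : ∃ i, w i ≠ 0 ∧ w (i + 1) ≠ 0 := by
      rcases hω.eq_or_eq_of_isMax hl0 (fun j => (hle j).trans_eq (hmax a ha).symm)
        ((hmax b hb).trans (hmax a ha).symm) hba with h | h
      · exact ⟨a, ha, h ▸ hb⟩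
      · exact ⟨b, hb, by rwa [h, sub_add_cancel]⟩
    have hzero : ∀ c, c ≠ i → c ≠ i + 1 → w c = 0 := fun c h1 h2 => by
      by_contra hc
      refine (hω.cross_pos h1 h2).ne' (cross_eq_zero_of_apply_eq_zero hl0 ?_ ?_)
      · rw [map_sub, hmax _ hi, hmax _ hi', sub_self]
      · rw [map_sub, hmax _ hi, hmax _ hc, sub_self]
    have hne := (hω.add_one_ne i).symm
    rw [Fintype.sum_eq_add i (i + 1) hne fun c hc => hzero c hc.1 hc.2] at hw1
    rw [Fintype.sum_eq_add i (i + 1) hne fun c hc => by simp [hzero c hc.1 hc.2]] at hwz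
    exact ⟨i, w i, w (i + 1), (hw0 i).lt_of_ne' hi, (hw0 _).lt_of_ne' hi', hw1, hwz⟩

theorem eq_of_mem_exteriorBisector (hω : IsConvexPolygon ω) {i : Fin k} {z : ℂ}
    (hz : z ∈ polygonRegion ω) (hz' : z ∈ exteriorBisector ω i) : z = ω i := by
  obtain ⟨t, ht, rfl⟩ := hz'
  rcases ht.eq_or_lt with rfl | ht
  · simp
  exfalso
  have h1 := hω.cross_nonneg i hz
  have h2 := hω.cross_adjacent_pos i
  have h3 : 0 < ‖ω (i - 1) - ω i‖ := by
    rw [norm_pos_iff]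
    intro h
    rw [h] at h2
    simp [cross_eq] at h2
  have h4 : cross (ω (i + 1) - ω i) (ω i - t * interiorBisectorDir ω i - ω i) =
      -(t * (cross (ω (i + 1) - ω i) (ω (i - 1) - ω i) / ‖ω (i - 1) - ω i‖)) := by
    simp only [cross_eq, interiorBisectorDir, sub_sub_cancel_left]
    simp [Complex.div_re, Complex.div_im, Complex.normSq_ofReal]
    field_simp
    ring
  rw [h4] at h1
  have h5 := mul_pos ht (div_pos h2 h3)
  linarith

/-- By Cauchy–Schwarz a sum of two unit vectors has a nonnegative inner product with each of them.
Hence the open half disc about either side direction avoids the slit. -/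
theorem not_mem_exteriorBisector_of_re_pos {i : Fin k} {z e : ℂ}
    (he : e = ω (i + 1) - ω i ∨ e = ω (i - 1) - ω i)
    (hz : 0 < (starRingEnd ℂ e * (z - ω i)).re) : z ∉ exteriorBisector ω i := by
  rintro ⟨t, ht, rfl⟩
  have key : ∀ u : ℂ, 0 ≤ (starRingEnd ℂ e * (e / ‖e‖ + u / ‖u‖)).re := fun u => by
    have h1 : starRingEnd ℂ e * (e / ‖e‖) = ‖e‖ := by
      rw [← mul_div_assoc, mul_comm, Complex.mul_conj, Complex.normSq_eq_norm_sq]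
      rcases eq_or_ne e 0 with rfl | h0
      · simp
      · have : (‖e‖ : ℂ) ≠ 0 := by simpa using h0
        push_cast
        field_simp
    have h2 : ‖starRingEnd ℂ e * (u / ‖u‖)‖ ≤ ‖e‖ := by
      rw [norm_mul, norm_div, RCLike.norm_conj]
      simp only [Complex.norm_real, norm_norm]
      exact mul_le_of_le_one_right (norm_nonneg _) (div_self_le_one _)
    have h3 := (Complex.abs_re_le_norm _).trans h2
    rw [mul_add, Complex.add_re, h1, Complex.ofReal_re]
    linarith [neg_le_of_abs_le h3]
  have h0 : 0 ≤ (starRingEnd ℂ e * interiorBisectorDir ω i).re := by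
    rcases he with rfl | rfl
    · exact key _
    · rw [interiorBisectorDir, add_comm]
      exact key _
  have h1 : (starRingEnd ℂ e * (ω i - t * interiorBisectorDir ω i - ω i)).re =
      -(t * (starRingEnd ℂ e * interiorBisectorDir ω i).re) := by
    simp
    ring
  rw [h1] at hz
  nlinarith [mul_nonneg ht h0]

end IsConvexPolygon

/-! ### Analytic continuation across a side -/

/-- `f` extends analytically from `K ∩ ball x r` to `ball x r`. -/
def ExtendsToBall (K : Set ℂ) (f : ℂ → ℂ) (x : ℂ) (r : ℝ) : Prop :=
  ∃ g : ℂ → ℂ, AnalyticOnNhd ℂ g (Metric.ball x r) ∧ EqOn g f (K ∩ Metric.ball x r)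

theorem ExtendsToBall.of_ball_subset {K : Set ℂ} {f : ℂ → ℂ} {x y : ℂ} {r s : ℝ}
    (h : ExtendsToBall K f x r) (hs : Metric.ball y s ⊆ Metric.ball x r) :
    ExtendsToBall K f y s := by
  obtain ⟨g, hg, he⟩ := h
  exact ⟨g, hg.mono hs, he.mono (inter_subset_inter_right _ hs)⟩

/-- The half disc about `p` of radius `R` whose axis of symmetry has direction `D`. -/
def halfBall (p D : ℂ) (R : ℝ) : Set ℂ :=
  Metric.ball p R ∩ {z | 0 < (starRingEnd ℂ D * (z - p)).re}

/-- `f` extends analytically from `K` to a half disc about `p` with axis in the direction `D`, and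
the extension is `O(|z - p| ^ δ)` there. -/
def ExtendsAtCorner (K : Set ℂ) (f : ℂ → ℂ) (δ : ℝ) (p D : ℂ) : Prop :=
  ∃ R : ℝ, 0 < R ∧ ∃ M : ℝ, ∃ g : ℂ → ℂ, AnalyticOnNhd ℂ g (halfBall p D R) ∧
    EqOn g f (K ∩ halfBall p D R) ∧ ∀ z ∈ halfBall p D R, ‖g z‖ ≤ M * ‖z - p‖ ^ δ

theorem ball_subset_halfBall {p D : ℂ} {R s : ℝ} (hR : 2 * (s * ‖D‖) ≤ R) (hs : 0 ≤ s) :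
    Metric.ball (p + s * D) (s * ‖D‖) ⊆ halfBall p D R := by
  intro w hw
  rw [Metric.mem_ball, dist_eq_norm] at hw
  have hsD : ‖(s : ℂ) * D‖ = s * ‖D‖ := by
    rw [norm_mul, Complex.norm_real, Real.norm_of_nonneg hs]
  have hD : 0 < ‖D‖ := by
    by_contra h
    have h0 : ‖D‖ = 0 := le_antisymm (not_lt.1 h) (norm_nonneg _)
    rw [h0, mul_zero] at hw
    exact (norm_nonneg _).not_gt hw
  constructor
  · rw [Metric.mem_ball, dist_eq_norm]
    have : w - p = (w - (p + s * D)) + s * D := by ring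
    rw [this]
    refine (norm_add_le _ _).trans_lt ?_
    rw [hsD]
    linarith
  · have h1 : (starRingEnd ℂ D * (w - p)).re =
        (starRingEnd ℂ D * (w - (p + s * D))).re + s * ‖D‖ ^ 2 := by
      rw [← Complex.normSq_eq_norm_sq, Complex.normSq_apply]
      simp
      ring
    have h2 := (Complex.abs_re_le_norm (starRingEnd ℂ D * (w - (p + s * D))))
    rw [norm_mul, RCLike.norm_conj] at h2
    have h3 := neg_le_of_abs_le h2
    have h4 := mul_lt_mul_of_pos_left hw hD
    rw [mem_ofPred_eq, h1]
    nlinarith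

/-- If the balls meet, the point dividing the segment of centres in the ratio of the radii lies in
both. It belongs to `K`, so interior points of `K` lie nearby, where both functions equal `f`; the
intersection is convex and the identity theorem applies. -/
theorem eqOn_ball_inter_ball {K : Set ℂ} (hK : K ⊆ closure (interior K)) {f g h : ℂ → ℂ}
    {x y : ℂ} (hxy : segment ℝ x y ⊆ K) {r s : ℝ} (hg : AnalyticOnNhd ℂ g (Metric.ball x r))
    (hgf : EqOn g f (K ∩ Metric.ball x r)) (hh : AnalyticOnNhd ℂ h (Metric.ball y s))
    (hhf : EqOn h f (K ∩ Metric.ball y s)) :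
    EqOn g h (Metric.ball x r ∩ Metric.ball y s) := by
  rintro w ⟨hw, hw'⟩
  have hr : 0 < r := Metric.pos_of_mem_ball hw
  have hs : 0 < s := Metric.pos_of_mem_ball hw'
  have hd : ‖y - x‖ < r + s := by
    rw [← dist_eq_norm]
    exact (dist_triangle y w x).trans_lt (by
      rw [Metric.mem_ball] at hw hw'
      rw [dist_comm y w]
      linarith)
  set m := x + (r / (r + s)) • (y - x) with hm
  have hmK : m ∈ K := by
    apply hxy
    rw [segment_eq_image']
    exact ⟨r / (r + s), ⟨by positivity, by rw [div_le_one (by positivity)]; linarith⟩, rfl⟩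
  have hmx : m ∈ Metric.ball x r := by
    rw [Metric.mem_ball, dist_eq_norm, hm, add_sub_cancel_left, norm_smul,
      Real.norm_of_nonneg (by positivity), div_mul_eq_mul_div, div_lt_iff₀ (by positivity)]
    gcongr
  have hmy : m ∈ Metric.ball y s := by
    have : m - y = -((s / (r + s)) • (y - x)) := by
      have h1 : (s / (r + s)) = 1 - r / (r + s) := by
        field_simp
        ring
      rw [hm, h1]
      module
    rw [Metric.mem_ball, dist_eq_norm, this, norm_neg, norm_smul,
      Real.norm_of_nonneg (by positivity), div_mul_eq_mul_div, div_lt_iff₀ (by positivity)]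
    gcongr
  have hopen : IsOpen (Metric.ball x r ∩ Metric.ball y s) := Metric.isOpen_ball.inter Metric.isOpen_ball
  obtain ⟨z, hz, hzK⟩ := mem_closure_iff.1 (hK hmK) _ hopen ⟨hmx, hmy⟩
  have hev : g =ᶠ[𝓝 z] h := by
    filter_upwards [hopen.mem_nhds hz, mem_interior_iff_mem_nhds.1 hzK] with u hu huK
    rw [hgf ⟨huK, hu.1⟩, hhf ⟨huK, hu.2⟩]
  exact (hg.mono inter_subset_left).eqOn_of_preconnected_of_eventuallyEq
    (hh.mono inter_subset_right)
    ((convex_ball x r).inter (convex_ball y s)).isPreconnected hz hev ⟨hw, hw'⟩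

/-- The radius shrinks only linearly at the end points, since the half discs there contain balls
tangent to their diameters. A Lebesgue number handles the compact middle part. This linear rate
makes room for a triangle. -/
theorem exists_forall_extendsToBall {K : Set ℂ} {f : ℂ → ℂ} {p D : ℂ} (hD : D ≠ 0)
    (hside : ∀ s ∈ Ioo (0 : ℝ) 1, AnalyticWithinAt ℂ f K (p + s * D))
    (hsub : ∀ s ∈ Ioo (0 : ℝ) 1, p + s * D ∈ K) {δ : ℝ}
    (hp : ExtendsAtCorner K f δ p D) (hp' : ExtendsAtCorner K f δ (p + D) (-D)) :
    ∃ c : ℝ, 0 < c ∧ c ≤ 1 ∧ ∀ s ∈ Ioo (0 : ℝ) 1,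
      ExtendsToBall K f (p + s * D) (c * min s (1 - s) * ‖D‖) := by
  obtain ⟨R, hR, -, g, hg, hgf, -⟩ := hp
  obtain ⟨R', hR', -, g', hg', hgf', -⟩ := hp'
  have hD' : 0 < ‖D‖ := norm_pos_iff.2 hD
  set s₀ := min R R' / (2 * ‖D‖) with hs₀
  have hs₀0 : 0 < s₀ := by positivity
  have hs₀R : 2 * (s₀ * ‖D‖) = min R R' := by
    rw [hs₀]
    field_simp
  have hleft : ∀ s ∈ Ioo (0 : ℝ) 1, s ≤ s₀ → ExtendsToBall K f (p + s * D) (s * ‖D‖) :=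
    fun s hs h => by
      have hsub := ball_subset_halfBall (p := p) (D := D) (R := R) (s := s)
        (by nlinarith [min_le_left R R']) hs.1.le
      exact ⟨g, hg.mono hsub, hgf.mono (inter_subset_inter_right _ hsub)⟩
  have hright : ∀ s ∈ Ioo (0 : ℝ) 1, 1 - s ≤ s₀ →
      ExtendsToBall K f (p + s * D) ((1 - s) * ‖D‖) := fun s hs h => by
    have hsub := ball_subset_halfBall (p := p + D) (D := -D) (R := R') (s := 1 - s)
      (by rw [norm_neg]; nlinarith [min_le_right R R']) (by linarith [hs.2])
    rw [norm_neg, show p + D + ((1 - s : ℝ) : ℂ) * -D = p + s * D by push_cast; ring] at hsub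
    exact ⟨g', hg'.mono hsub, hgf'.mono (inter_subset_inter_right _ hsub)⟩
  have hloc : ∀ s ∈ Ioo (0 : ℝ) 1, ∃ r : ℝ, 0 < r ∧ ExtendsToBall K f (p + s * D) r := fun s hs => by
    obtain ⟨h, hfh, hh⟩ := analyticWithinAt_iff_exists_analyticAt.1 (hside s hs)
    rw [insert_eq_of_mem (hsub s hs)] at hfh
    obtain ⟨r, hr, hrs⟩ := Metric.eventually_nhds_iff_ball.1 hh.eventually_analyticAt
    obtain ⟨r', hr', hrs'⟩ := Metric.mem_nhdsWithin_iff.1 hfh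
    refine ⟨min r r', lt_min hr hr', h,
      fun z hz => hrs z (Metric.ball_subset_ball (min_le_left _ _) hz), fun z hz => ?_⟩
    exact (hrs' ⟨Metric.ball_subset_ball (min_le_right _ _) hz.2, hz.1⟩).symm
  choose! r hr hrE using hloc
  have hcomp : IsCompact ((fun s : ℝ => p + s * D) '' (Icc s₀ (1 - s₀))) :=
    isCompact_Icc.image (by fun_prop)
  obtain ⟨ρ, hρ, hρs⟩ := lebesgue_number_lemma_of_metric
    (c := fun s : Ioo (0 : ℝ) 1 => Metric.ball (p + (s : ℝ) * D) (r s)) hcomp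
    (fun _ => Metric.isOpen_ball) (by
      rintro _ ⟨s, hs, rfl⟩
      have hs' : s ∈ Ioo (0 : ℝ) 1 := ⟨by linarith [hs.1], by linarith [hs.2]⟩
      exact mem_iUnion.2 ⟨⟨s, hs'⟩, Metric.mem_ball_self (hr s hs')⟩)
  refine ⟨min 1 (ρ / ‖D‖), by positivity, min_le_left _ _, fun s hs => ?_⟩
  have hs1 : 0 < 1 - s := by linarith [hs.2]
  have hmin : 0 < min s (1 - s) := lt_min hs.1 hs1
  by_cases h1 : s ≤ s₀
  · refine (hleft s hs h1).of_ball_subset (Metric.ball_subset_ball ?_)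
    gcongr
    exact (mul_le_of_le_one_left hmin.le (min_le_left _ _)).trans (min_le_left _ _)
  by_cases h2 : 1 - s ≤ s₀
  · refine (hright s hs h2).of_ball_subset (Metric.ball_subset_ball ?_)
    gcongr
    exact (mul_le_of_le_one_left hmin.le (min_le_left _ _)).trans (min_le_right _ _)
  obtain ⟨i, hi⟩ := hρs (p + s * D) ⟨s, ⟨by linarith, by linarith⟩, rfl⟩
  refine (hrE i i.2).of_ball_subset ((Metric.ball_subset_ball ?_).trans hi)
  calc min 1 (ρ / ‖D‖) * min s (1 - s) * ‖D‖ ≤ ρ / ‖D‖ * 1 * ‖D‖ := by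
        gcongr
        · exact min_le_right _ _
        · exact (min_le_left _ _).trans hs.2.le
    _ = ρ := by field_simp

theorem exists_le_mul_rpow {φ : ℝ → ℂ} (hφ : ContinuousOn φ (Icc 0 1)) {δ t₀ M : ℝ}
    (hδ : 0 ≤ δ) (ht₀ : 0 < t₀) (hM : ∀ t, 0 < t → t < t₀ → ‖φ t‖ ≤ M * t ^ δ) :
    ∃ M' : ℝ, ∀ t ∈ Ioc (0 : ℝ) 1, ‖φ t‖ ≤ M' * t ^ δ := by
  obtain ⟨B, hB⟩ := isCompact_Icc.exists_bound_of_continuousOn hφ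
  have hB0 : 0 ≤ B := (norm_nonneg _).trans (hB 0 (by simp))
  refine ⟨max M (B / t₀ ^ δ), fun t ht => ?_⟩
  have h0 : 0 ≤ t ^ δ := Real.rpow_nonneg ht.1.le _
  by_cases h : t < t₀
  · exact (hM t ht.1 h).trans (mul_le_mul_of_nonneg_right (le_max_left _ _) h0)
  · refine (hB t ⟨ht.1.le, ht.2⟩).trans ?_
    refine le_trans ?_ (mul_le_mul_of_nonneg_right (le_max_right _ _) h0)
    have h1 : 0 < t₀ ^ δ := Real.rpow_pos_of_pos ht₀ _
    rw [div_mul_eq_mul_div, le_div_iff₀ h1]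
    gcongr
    exact not_lt.1 h

/-- The thin isosceles triangle with base from `p` to `p + D` and apex `p + (1 - κ I) D / 2`. -/
def thinTriangle (κ : ℝ) (p D : ℂ) : Set ℂ :=
  {z | 0 ≤ -((z - p) / D).im ∧ -((z - p) / D).im ≤ κ * ((z - p) / D).re ∧
    -((z - p) / D).im ≤ κ * (1 - ((z - p) / D).re)}

/-- The apex of `thinTriangle`. -/
def apex (κ : ℝ) (p D : ℂ) : ℂ := p + (1 / 2 - κ / 2 * Complex.I) * D

theorem mem_thinTriangle_iff {κ : ℝ} {p D u : ℂ} (hD : D ≠ 0) :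
    p + u * D ∈ thinTriangle κ p D ↔ 0 ≤ -u.im ∧ -u.im ≤ κ * u.re ∧ -u.im ≤ κ * (1 - u.re) := by
  simp [thinTriangle, hD]

theorem convex_thinTriangle (κ : ℝ) (p D : ℂ) : Convex ℝ (thinTriangle κ p D) := by
  intro x hx y hy a b ha hb hab
  have h : (a • x + b • y - p) / D = (a : ℂ) * ((x - p) / D) + (b : ℂ) * ((y - p) / D) := by
    have h1 : (b : ℂ) = 1 - a := by
      rw [eq_sub_iff_add_eq']
      exact_mod_cast hab
    simp only [Complex.real_smul, h1]
    ring
  obtain ⟨h1, h2, h3⟩ := hx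
  obtain ⟨h4, h5, h6⟩ := hy
  simp only [thinTriangle, mem_ofPred_eq, h]
  obtain rfl : b = 1 - a := by linarith
  simp only [Complex.add_re, Complex.add_im, Complex.re_ofReal_mul, Complex.im_ofReal_mul]
  refine ⟨?_, ?_, ?_⟩
  · nlinarith [mul_nonneg ha h1, mul_nonneg hb h4]
  · nlinarith [mul_le_mul_of_nonneg_left h2 ha, mul_le_mul_of_nonneg_left h5 hb]
  · nlinarith [mul_le_mul_of_nonneg_left h3 ha, mul_le_mul_of_nonneg_left h6 hb]

theorem interior_thinTriangle_nonempty {κ : ℝ} (hκ : 0 < κ) (p : ℂ) {D : ℂ} (hD : D ≠ 0) :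
    (interior (thinTriangle κ p D)).Nonempty := by
  have h1 : Continuous fun z : ℂ => -((z - p) / D).im := by fun_prop
  have h2 : Continuous fun z : ℂ => κ * ((z - p) / D).re := by fun_prop
  have h3 : Continuous fun z : ℂ => κ * (1 - ((z - p) / D).re) := by fun_prop
  have hopen := (isOpen_lt (continuous_const (y := (0 : ℝ))) h1).inter ((isOpen_lt h1 h2).inter (isOpen_lt h1 h3))
  refine ⟨p + (1 / 2 - κ / 4 * Complex.I) * D, interior_maximal ?_ hopen ?_⟩
  · exact fun z hz => ⟨(mem_ofPred_eq ▸ hz.1).le, (mem_ofPred_eq ▸ hz.2.1).le,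
      (mem_ofPred_eq ▸ hz.2.2).le⟩
  · have h4 : (p + (1 / 2 - κ / 4 * Complex.I) * D - p) / D = 1 / 2 - κ / 4 * Complex.I := by
      field_simp
      ring
    simp only [mem_inter_iff, mem_ofPred_eq, h4]
    norm_num
    exact ⟨by linarith, by linarith⟩

theorem exists_add_mul_eq {D : ℂ} (hD : D ≠ 0) (p z : ℂ) : ∃ u : ℂ, z = p + u * D :=
  ⟨(z - p) / D, by field_simp; ring⟩

theorem neg_im_pos_of_mem_interior_thinTriangle {κ : ℝ} {p D u : ℂ} (hD : D ≠ 0)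
    (h : p + u * D ∈ interior (thinTriangle κ p D)) : 0 < -u.im := by
  have hc : Tendsto (fun ε : ℝ => p + (u + ε * Complex.I) * D) (𝓝[>] 0) (𝓝 (p + u * D)) := by
    have : Continuous (fun ε : ℝ => p + (u + ε * Complex.I) * D) := by fun_prop
    simpa using (this.tendsto 0).mono_left nhdsWithin_le_nhds
  obtain ⟨ε, h1, h2⟩ := ((hc.eventually (mem_interior_iff_mem_nhds.1 h)).and
    self_mem_nhdsWithin).exists
  have h3 := ((mem_thinTriangle_iff hD).1 h1).1
  have h4 : (0 : ℝ) < ε := h2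
  simp at h3
  linarith

/-- A function on `K` that extends analytically across the open segment from `p` to `p + D` and to
half discs at its end points extends to a thin triangle over the segment, with the same order of
vanishing at the end points. -/
theorem exists_extension_thinTriangle {K : Set ℂ} (hK : K ⊆ closure (interior K)) {f : ℂ → ℂ}
    {p D : ℂ} (hD : D ≠ 0)
    (hside : ∀ s ∈ Ioo (0 : ℝ) 1, AnalyticWithinAt ℂ f K (p + s * D))
    (hsub : ∀ s ∈ Ioo (0 : ℝ) 1, p + s * D ∈ K) {δ : ℝ} (hδ : 0 < δ)
    (hp : ExtendsAtCorner K f δ p D) (hp' : ExtendsAtCorner K f δ (p + D) (-D)) :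
    ∃ κ : ℝ, 0 < κ ∧ ∃ F : ℂ → ℂ, ContinuousOn F (thinTriangle κ p D) ∧
      DifferentiableOn ℂ F (interior (thinTriangle κ p D)) ∧
      (∀ s ∈ Ioo (0 : ℝ) 1, F (p + s * D) = f (p + s * D)) ∧ F p = 0 ∧ F (p + D) = 0 ∧
      ∃ t₀ : ℝ, 0 < t₀ ∧ ∃ M : ℝ, ∀ u : ℂ, p + u * D ∈ thinTriangle κ p D →
        (u.re < t₀ → ‖F (p + u * D)‖ ≤ M * ‖u * D‖ ^ δ) ∧
        (1 - u.re < t₀ → ‖F (p + u * D)‖ ≤ M * ‖(1 - u) * D‖ ^ δ) := by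
  classical
  have hD' : 0 < ‖D‖ := norm_pos_iff.2 hD
  obtain ⟨c, hc0, hc1, hext⟩ := exists_forall_extendsToBall hD hside hsub hp hp'
  obtain ⟨R, hR, M, g, hg, hgf, hgM⟩ := hp
  obtain ⟨R', hR', M', g', hg', hgf', hgM'⟩ := hp'
  choose! G hG hGf using hext
  set B : ℝ → Set ℂ := fun s => Metric.ball (p + s * D) (c * min s (1 - s) * ‖D‖) with hB
  -- The extensions agree on overlaps, so the choice of `s` is immaterial. The default `0` is the
  -- value at both end points, which lie in none of the open balls because `c ≤ 1`.
  set F : ℂ → ℂ := fun w => if h : ∃ s ∈ Ioo (0 : ℝ) 1, w ∈ B s then G h.choose w else 0 with hF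
  have hsegK : ∀ s ∈ Ioo (0 : ℝ) 1, ∀ t ∈ Ioo (0 : ℝ) 1,
      segment ℝ (p + s * D) (p + t * D) ⊆ K := fun s hs t ht => by
    rintro _ ⟨a, b, ha, hb, hab, rfl⟩
    have h1 : a • (p + s * D) + b • (p + t * D) = p + ((a * s + b * t : ℝ) : ℂ) * D := by
      have : (a : ℂ) + b = 1 := by exact_mod_cast hab
      simp only [Complex.real_smul]
      push_cast
      linear_combination p * this
    rw [h1]
    exact hsub _ ((convex_Ioo (0 : ℝ) 1) hs ht ha hb hab)
  have hFG : ∀ s ∈ Ioo (0 : ℝ) 1, EqOn F (G s) (B s) := fun s hs w hw => by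
    have h : ∃ s ∈ Ioo (0 : ℝ) 1, w ∈ B s := ⟨s, hs, hw⟩
    simp only [hF, dif_pos h]
    exact eqOn_ball_inter_ball hK (hsegK _ h.choose_spec.1 _ hs) (hG _ h.choose_spec.1)
      (hGf _ h.choose_spec.1) (hG s hs) (hGf s hs) ⟨h.choose_spec.2, hw⟩
  have hrs : ∀ s ∈ Ioo (0 : ℝ) 1, 0 < c * min s (1 - s) * ‖D‖ := fun s hs => by
    have : 0 < min s (1 - s) := lt_min hs.1 (by linarith [hs.2])
    positivity
  have hrs1 : ∀ s ∈ Ioo (0 : ℝ) 1, c * min s (1 - s) * ‖D‖ ≤ s * ‖D‖ ∧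
      c * min s (1 - s) * ‖D‖ ≤ (1 - s) * ‖D‖ := fun s hs => by
    have : 0 < min s (1 - s) := lt_min hs.1 (by linarith [hs.2])
    constructor
    · gcongr
      exact (mul_le_of_le_one_left this.le hc1).trans (min_le_left _ _)
    · gcongr
      exact (mul_le_of_le_one_left this.le hc1).trans (min_le_right _ _)
  have hFp : F p = 0 := by
    rw [hF]
    refine dif_neg ?_
    rintro ⟨s, hs, h⟩
    rw [hB, Metric.mem_ball, dist_eq_norm, sub_add_cancel_left, norm_neg, norm_mul,
      Complex.norm_real, Real.norm_of_nonneg hs.1.le] at h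
    exact h.not_ge (hrs1 s hs).1
  have hFp' : F (p + D) = 0 := by
    rw [hF]
    refine dif_neg ?_
    rintro ⟨s, hs, h⟩
    rw [hB, Metric.mem_ball, dist_eq_norm,
      show p + D - (p + s * D) = ((1 - s : ℝ) : ℂ) * D by push_cast; ring, norm_mul,
      Complex.norm_real, Real.norm_of_nonneg (by linarith [hs.2])] at h
    exact h.not_ge (hrs1 s hs).2
  have hFd : ∀ s ∈ Ioo (0 : ℝ) 1, ∀ w ∈ B s, DifferentiableAt ℂ F w := fun s hs w hw =>
    ((hG s hs w hw).differentiableAt).congr_of_eventuallyEq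
      ((hFG s hs).eventuallyEq_of_mem (Metric.isOpen_ball.mem_nhds hw))
  -- Strictly below `c`, so that a point of the triangle other than its base corners lies in the
  -- open ball about its foot on the side.
  set κ := c / 2 with hκ
  have hκ0 : 0 < κ := by positivity
  have hmemB : ∀ u : ℂ, p + u * D ∈ thinTriangle κ p D → u.re ∈ Ioo (0 : ℝ) 1 →
      p + u * D ∈ B u.re := fun u hu hre => by
    obtain ⟨h1, h2, h3⟩ := (mem_thinTriangle_iff hD).1 hu
    have h0 : 0 < min u.re (1 - u.re) := lt_min hre.1 (by linarith [hre.2])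
    have h4 : p + u * D - (p + u.re * D) = (u.im * Complex.I) * D := by
      linear_combination -D * Complex.re_add_im u
    rw [hB, Metric.mem_ball, dist_eq_norm, h4, norm_mul, norm_mul, Complex.norm_real,
      Complex.norm_I, mul_one, Real.norm_of_nonpos (by linarith)]
    gcongr
    have h5 : -u.im ≤ κ * min u.re (1 - u.re) := by
      rcases min_choice u.re (1 - u.re) with h | h
      · rw [h]
        exact h2
      · rw [h]
        exact h3
    refine h5.trans_lt ?_
    gcongr
    rw [hκ]
    linarith
  have hcases : ∀ u : ℂ, p + u * D ∈ thinTriangle κ p D → u = 0 ∨ u = 1 ∨ u.re ∈ Ioo (0 : ℝ) 1 :=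
    fun u hu => by
      obtain ⟨h1, h2, h3⟩ := (mem_thinTriangle_iff hD).1 hu
      have h4 : 0 ≤ u.re := by
        by_contra h
        nlinarith
      have h5 : u.re ≤ 1 := by
        by_contra h
        nlinarith
      rcases h4.eq_or_lt with h6 | h6
      · left
        rw [← h6] at h2
        exact Complex.ext h6.symm (by simp; linarith)
      rcases h5.eq_or_lt with h7 | h7
      · right
        left
        rw [h7] at h3
        exact Complex.ext h7 (by simp; linarith)
      · exact Or.inr (Or.inr ⟨h6, h7⟩)
  set t₀ := min R R' / (2 * ‖D‖) with ht₀
  have ht₀0 : 0 < t₀ := by positivity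
  have ht₀R : 2 * (t₀ * ‖D‖) = min R R' := by
    rw [ht₀]
    field_simp
  have hM0 : 0 ≤ |M| + |M'| := by positivity
  have hzero : ∀ u : ℂ, 0 ≤ (|M| + |M'|) * ‖u * D‖ ^ δ := fun u => by positivity
  have hnear : ∀ u : ℂ, p + u * D ∈ thinTriangle κ p D → u.re < t₀ →
      ‖F (p + u * D)‖ ≤ (|M| + |M'|) * ‖u * D‖ ^ δ := fun u hu hlt => by
    rcases hcases u hu with rfl | rfl | hre
    · simp [hFp, Real.zero_rpow hδ.ne']
    · rw [one_mul, hFp', norm_zero]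
      positivity
    · have hw := hmemB u hu hre
      have hs := ball_subset_halfBall (p := p) (D := D) (R := R) (s := u.re)
        (by nlinarith [min_le_left R R']) hre.1.le
      have hwb := Metric.ball_subset_ball (hrs1 _ hre).1 hw
      have h1 : F (p + u * D) = g (p + u * D) := by
        rw [hFG _ hre hw]
        exact eqOn_ball_inter_ball hK (hsegK _ hre _ hre) (hG _ hre) (hGf _ hre) (hg.mono hs)
          (hgf.mono (inter_subset_inter_right _ hs)) ⟨hw, hwb⟩
      rw [h1]
      refine (hgM _ (hs hwb)).trans ?_
      rw [add_sub_cancel_left]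
      gcongr
      exact (le_abs_self M).trans (by linarith [abs_nonneg M'])
  have hnear' : ∀ u : ℂ, p + u * D ∈ thinTriangle κ p D → 1 - u.re < t₀ →
      ‖F (p + u * D)‖ ≤ (|M| + |M'|) * ‖(1 - u) * D‖ ^ δ := fun u hu hlt => by
    rcases hcases u hu with rfl | rfl | hre
    · rw [zero_mul, add_zero, hFp, norm_zero]
      positivity
    · simp [hFp', Real.zero_rpow hδ.ne']
    · have hw := hmemB u hu hre
      have hs := ball_subset_halfBall (p := p + D) (D := -D) (R := R') (s := 1 - u.re)
        (by rw [norm_neg]; nlinarith [min_le_right R R']) (by linarith [hre.2])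
      rw [norm_neg, show p + D + ((1 - u.re : ℝ) : ℂ) * -D = p + u.re * D by push_cast; ring] at hs
      have hwb := Metric.ball_subset_ball (hrs1 _ hre).2 hw
      have h1 : F (p + u * D) = g' (p + u * D) := by
        rw [hFG _ hre hw]
        exact eqOn_ball_inter_ball hK (hsegK _ hre _ hre) (hG _ hre) (hGf _ hre) (hg'.mono hs)
          (hgf'.mono (inter_subset_inter_right _ hs)) ⟨hw, hwb⟩
      rw [h1]
      refine (hgM' _ (hs hwb)).trans ?_
      rw [show p + u * D - (p + D) = -((1 - u) * D) by ring, norm_neg]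
      gcongr
      exact (le_abs_self M').trans (by linarith [abs_nonneg M])
  refine ⟨κ, hκ0, F, ?_, ?_, fun s hs => ?_, hFp, hFp', t₀, ht₀0, |M| + |M'|,
    fun u hu => ⟨hnear u hu, hnear' u hu⟩⟩
  · intro z hz
    obtain ⟨u, rfl⟩ := exists_add_mul_eq hD p z
    have hcre : Continuous fun z : ℂ => ((z - p) / D).re := by fun_prop
    rcases hcases u hz with rfl | rfl | hre
    · rw [zero_mul, add_zero, ContinuousWithinAt, hFp]
      have hev : ∀ᶠ z in 𝓝[thinTriangle κ p D] p, ‖F z‖ ≤ (|M| + |M'|) * ‖z - p‖ ^ δ := by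
        have h1 : ∀ᶠ z in 𝓝[thinTriangle κ p D] p, ((z - p) / D).re < t₀ :=
          (hcre.tendsto p).mono_left nhdsWithin_le_nhds |>.eventually_lt_const (by simpa using ht₀0)
        filter_upwards [h1, self_mem_nhdsWithin] with z h1 h2
        obtain ⟨u, rfl⟩ := exists_add_mul_eq hD p z
        rw [add_sub_cancel_left, mul_div_cancel_right₀ _ hD] at h1
        rw [add_sub_cancel_left]
        exact hnear u h2 h1
      refine squeeze_zero_norm' hev ?_
      have h2 : Continuous fun z : ℂ => (|M| + |M'|) * ‖z - p‖ ^ δ :=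
        continuous_const.mul ((by fun_prop : Continuous fun z : ℂ => ‖z - p‖).rpow_const
          fun _ => Or.inr hδ.le)
      have h3 := (h2.tendsto p).mono_left (nhdsWithin_le_nhds (s := thinTriangle κ p D))
      simpa [Real.zero_rpow hδ.ne'] using h3
    · rw [one_mul, ContinuousWithinAt, hFp']
      have hev : ∀ᶠ z in 𝓝[thinTriangle κ p D] (p + D),
          ‖F z‖ ≤ (|M| + |M'|) * ‖z - (p + D)‖ ^ δ := by
        have h1 : ∀ᶠ z in 𝓝[thinTriangle κ p D] (p + D), 1 - t₀ < ((z - p) / D).re :=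
          (hcre.tendsto (p + D)).mono_left nhdsWithin_le_nhds |>.eventually_const_lt
            (by simpa [hD] using ht₀0)
        filter_upwards [h1, self_mem_nhdsWithin] with z h1 h2
        obtain ⟨u, rfl⟩ := exists_add_mul_eq hD p z
        rw [add_sub_cancel_left, mul_div_cancel_right₀ _ hD] at h1
        rw [show p + u * D - (p + D) = -((1 - u) * D) by ring, norm_neg]
        exact hnear' u h2 (by linarith)
      refine squeeze_zero_norm' hev ?_
      have h2 : Continuous fun z : ℂ => (|M| + |M'|) * ‖z - (p + D)‖ ^ δ :=
        continuous_const.mul ((by fun_prop : Continuous fun z : ℂ => ‖z - (p + D)‖).rpow_const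
          fun _ => Or.inr hδ.le)
      have h3 := (h2.tendsto (p + D)).mono_left (nhdsWithin_le_nhds (s := thinTriangle κ p D))
      simpa [Real.zero_rpow hδ.ne'] using h3
    · exact (hFd _ hre _ (hmemB u hz hre)).continuousAt.continuousWithinAt
  · intro z hz
    obtain ⟨u, rfl⟩ := exists_add_mul_eq hD p z
    have h1 := neg_im_pos_of_mem_interior_thinTriangle hD hz
    rcases hcases u (interior_subset hz) with rfl | rfl | hre
    · simp at h1
    · simp at h1
    · exact (hFd _ hre _ (hmemB u (interior_subset hz) hre)).differentiableWithinAt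
  · have hw : p + s * D ∈ B s := Metric.mem_ball_self (hrs s hs)
    rw [hFG s hs hw]
    exact hGf s hs ⟨hsub s hs, hw⟩

/-! ### Deforming a side to the outer legs of the triangle -/

theorem cross_mul_self (D u : ℂ) : cross D (u * D) = u.im * ‖D‖ ^ 2 := by
  rw [← Complex.normSq_eq_norm_sq, Complex.normSq_apply, cross_eq]
  simp
  ring

/-- The Cauchy integral over a side of a convex set, with a density that vanishes at the end points
and extends across the side. -/
theorem hasRootExpApprox_cauchyIntegral_segment {K : Set ℂ} (hK : K ⊆ closure (interior K))
    {f : ℂ → ℂ} {p D : ℂ} (hD : D ≠ 0)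
    (hside : ∀ s ∈ Ioo (0 : ℝ) 1, AnalyticWithinAt ℂ f K (p + s * D))
    (hsub : ∀ s ∈ Ioo (0 : ℝ) 1, p + s * D ∈ K) {δ : ℝ} (hδ : 0 < δ)
    (hp : ExtendsAtCorner K f δ p D) (hp' : ExtendsAtCorner K f δ (p + D) (-D))
    (hfp : f p = 0) (hfp' : f (p + D) = 0)
    (hKp : K ⊆ halfPlane p (Complex.I * D)) (hKp' : K ⊆ halfPlane (p + D) (Complex.I * D)) :
    HasRootExpApprox K (fun z => segmentIntegral (fun ζ => f ζ / (ζ - z)) p (p + D)) := by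
  obtain ⟨κ, hκ, F, hFc, hFd, hFf, hFp, hFp', t₀, ht₀, M, hM⟩ :=
    exists_extension_thinTriangle hK hD hside hsub hδ hp hp'
  set T := thinTriangle κ p D with hT
  set q := apex κ p D with hq
  set v : ℂ := (1 / 2 - κ / 2 * Complex.I) * D with hv
  set v' : ℂ := (-(1 / 2) - κ / 2 * Complex.I) * D with hv'
  have hqv : q - p = v := by
    rw [hq, apex, hv]
    ring
  have hqv' : q - (p + D) = v' := by
    rw [hq, apex, hv']
    ring
  have hD0 : 0 < ‖D‖ ^ 2 := pow_pos (norm_pos_iff.2 hD) 2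
  have hvneg : (starRingEnd ℂ (Complex.I * D) * v).re < 0 := by
    rw [re_conj_I_mul, hv, cross_mul_self]
    have : ((1 / 2 : ℂ) - κ / 2 * Complex.I).im = -(κ / 2) := by simp
    rw [this]
    nlinarith
  have hvneg' : (starRingEnd ℂ (Complex.I * D) * v').re < 0 := by
    rw [re_conj_I_mul, hv', cross_mul_self]
    have : (-(1 / 2 : ℂ) - κ / 2 * Complex.I).im = -(κ / 2) := by simp
    rw [this]
    nlinarith
  have hmem : ∀ t ∈ Icc (0 : ℝ) 1, p + (t * (1 / 2 - κ / 2 * Complex.I)) * D ∈ T := fun t ht => by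
    rw [hT, mem_thinTriangle_iff hD]
    simp only [Complex.re_ofReal_mul, Complex.im_ofReal_mul]
    norm_num
    have := mul_nonneg ht.1 hκ.le
    have := mul_nonneg (sub_nonneg.2 ht.2) hκ.le
    refine ⟨?_, ?_, ?_⟩ <;> nlinarith
  have hmem' : ∀ t ∈ Icc (0 : ℝ) 1,
      p + (1 + t * (-(1 / 2) - κ / 2 * Complex.I)) * D ∈ T := fun t ht => by
    rw [hT, mem_thinTriangle_iff hD]
    simp only [Complex.add_re, Complex.add_im, Complex.re_ofReal_mul, Complex.im_ofReal_mul]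
    norm_num
    have := mul_nonneg ht.1 hκ.le
    have := mul_nonneg (sub_nonneg.2 ht.2) hκ.le
    refine ⟨?_, ?_, ?_⟩ <;> nlinarith
  have heq : ∀ t : ℝ, p + t * v = p + (t * (1 / 2 - κ / 2 * Complex.I)) * D := fun t => by
    rw [hv]
    ring
  have heq' : ∀ t : ℝ, p + D + t * v' = p + (1 + t * (-(1 / 2) - κ / 2 * Complex.I)) * D :=
    fun t => by
      rw [hv']
      ring
  have hcont : ContinuousOn (fun t : ℝ => F (p + t * v)) (Icc 0 1) :=
    hFc.comp (by fun_prop) fun t ht => by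
      rw [heq]
      exact hmem t ht
  have hcont' : ContinuousOn (fun t : ℝ => F (p + D + t * v')) (Icc 0 1) :=
    hFc.comp (by fun_prop) fun t ht => by
      rw [heq']
      exact hmem' t ht
  obtain ⟨B, hB⟩ := exists_le_mul_rpow (hcont.mul (continuousOn_const (c := v))) hδ.le
    (t₀ := min 1 t₀) (M := M * ‖v‖ ^ δ * ‖v‖) (by positivity) fun t ht htlt => by
      have htI : t ∈ Icc (0 : ℝ) 1 := ⟨ht.le, htlt.le.trans (min_le_left _ _)⟩
      have h1 := (hM _ (hmem t htI)).1 (by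
        have := htlt.trans_le (min_le_right _ _)
        norm_num
        linarith)
      rw [mul_assoc (t : ℂ), ← hv, norm_mul (t : ℂ), Complex.norm_real, Real.norm_of_nonneg ht.le,
        Real.mul_rpow ht.le (norm_nonneg _)] at h1
      simp only [Pi.mul_apply]
      rw [norm_mul, heq, mul_assoc (t : ℂ), ← hv]
      refine (mul_le_mul_of_nonneg_right h1 (norm_nonneg v)).trans_eq ?_
      ring
  obtain ⟨B', hB'⟩ := exists_le_mul_rpow (hcont'.mul (continuousOn_const (c := v'))) hδ.le
    (t₀ := min 1 t₀) (M := M * ‖v'‖ ^ δ * ‖v'‖) (by positivity) fun t ht htlt => by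
      have htI : t ∈ Icc (0 : ℝ) 1 := ⟨ht.le, htlt.le.trans (min_le_left _ _)⟩
      have h1 := (hM _ (hmem' t htI)).2 (by
        have := htlt.trans_le (min_le_right _ _)
        norm_num
        linarith)
      rw [← heq', show (1 - (1 + t * (-(1 / 2) - κ / 2 * Complex.I))) * D = -(t * v') by
        rw [hv']; ring, norm_neg, norm_mul (t : ℂ), Complex.norm_real,
        Real.norm_of_nonneg ht.le, Real.mul_rpow ht.le (norm_nonneg _)] at h1
      simp only [Pi.mul_apply]
      rw [norm_mul]
      refine (mul_le_mul_of_nonneg_right h1 (norm_nonneg v')).trans_eq ?_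
      ring
  have happ := hasRootExpApprox_cauchyIntegral_ray hKp hvneg
    (hcont.mul (continuousOn_const (c := v))) hδ hB
  have happ' := hasRootExpApprox_cauchyIntegral_ray hKp' hvneg'
    (hcont'.mul (continuousOn_const (c := v'))) hδ hB'
  refine (happ.add (happ'.const_mul (-1))).congr fun z hz => ?_
  have hzpos := re_pos_of_mem_interior_halfPlane (mul_ne_zero Complex.I_ne_zero hD)
    (interior_mono hKp hz)
  rw [re_conj_I_mul] at hzpos
  -- The point `z` is strictly to the left of the side and the triangle is on the other side, so the
  -- Cauchy kernel has no pole in `T` and the path may be deformed.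
  have hzT : ∀ w ∈ T, w - z ≠ 0 := fun w hw h => by
    rw [← sub_eq_zero.1 h] at hzpos
    obtain ⟨u, rfl⟩ := exists_add_mul_eq hD p w
    rw [add_sub_cancel_left, cross_mul_self] at hzpos
    have := ((mem_thinTriangle_iff hD).1 hw).1
    nlinarith
  obtain ⟨H, hH⟩ := exists_segmentIntegral_eq_sub (convex_thinTriangle κ p D)
    (interior_thinTriangle_nonempty hκ p hD) (h := fun ζ => F ζ / (ζ - z))
    (hFc.div (by fun_prop) hzT)
    (hFd.div (by fun_prop) fun w hw => hzT w (interior_subset hw))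
  have hpT : p ∈ T := by simpa using hmem 0 (by simp)
  have hpT' : p + D ∈ T := by simpa using hmem' 0 (by simp)
  have hqT : q ∈ T := by
    have := hmem 1 (by simp)
    rwa [← heq, Complex.ofReal_one, one_mul, ← hqv, add_sub_cancel] at this
  have hfF : segmentIntegral (fun ζ => f ζ / (ζ - z)) p (p + D) =
      segmentIntegral (fun ζ => F ζ / (ζ - z)) p (p + D) := by
    refine segmentIntegral_congr fun t ht => ?_
    rw [add_sub_cancel_left]
    rcases ht.1.eq_or_lt with rfl | h0
    · simp [hFp, hfp]
    rcases ht.2.eq_or_lt with rfl | h1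
    · simp [hFp', hfp']
    · rw [hFf t ⟨h0, h1⟩]
  have e1 : segmentIntegral (fun ζ => F ζ / (ζ - z)) p q =
      ∫ t in (0 : ℝ)..1, F (p + t * v) * v / (p + t * v - z) := by
    rw [segmentIntegral, hqv]
    refine intervalIntegral.integral_congr fun t _ => ?_
    ring
  have e2 : segmentIntegral (fun ζ => F ζ / (ζ - z)) (p + D) q =
      ∫ t in (0 : ℝ)..1, F (p + D + t * v') * v' / (p + D + t * v' - z) := by
    rw [segmentIntegral, hqv']
    refine intervalIntegral.integral_congr fun t _ => ?_
    ring
  simp only [Pi.mul_apply]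
  rw [← e1, ← e2, hfF, hH p hpT q hqT, hH _ hpT' q hqT, hH p hpT _ hpT']
  ring

/-! ### Winding integral and Cauchy's formula for the polygon -/

theorem sum_sub_add_one_eq_zero {k : ℕ} [NeZero k] (H : Fin k → ℂ) : ∑ i, (H (i + 1) - H i) = 0 := by
  rw [Finset.sum_sub_distrib, sub_eq_zero]
  exact Equiv.sum_comp (Equiv.addRight (1 : Fin k)) H

theorem ratio_im_pos {w w' z : ℂ} (h : 0 < cross (w' - w) (z - w)) {t : ℝ} (ht : 0 < t) :
    0 < ((w + t * (w' - w) - z) / (w - z)).im := by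
  have hne : w - z ≠ 0 := by
    intro h0
    rw [sub_eq_zero.1 h0] at h
    simp [cross_eq] at h
  have h1 : 0 < Complex.normSq (w - z) := Complex.normSq_pos.2 hne
  have h2 : ((w + t * (w' - w) - z) / (w - z)).im =
      t * cross (w' - w) (z - w) / Complex.normSq (w - z) := by
    rw [Complex.div_im, cross_eq]
    simp
    field_simp
    ring
  rw [h2]
  positivity

/-- Seen from `z` on the left, the ratio starts at `1` and then stays in the upper half plane, so
the principal logarithm is a primitive along the whole segment. -/
theorem segmentIntegral_inv_sub {w w' z : ℂ} (h : 0 < cross (w' - w) (z - w)) :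
    segmentIntegral (fun ζ => 1 / (ζ - z)) w w' = Complex.log ((w' - z) / (w - z)) := by
  have hne : w - z ≠ 0 := by
    intro h0
    rw [sub_eq_zero.1 h0] at h
    simp [cross_eq] at h
  have hslit : ∀ t ∈ Icc (0 : ℝ) 1, (w + t * (w' - w) - z) / (w - z) ∈ Complex.slitPlane :=
    fun t ht => by
      rcases ht.1.eq_or_lt with rfl | h0
      · simp [div_self hne]
      · exact Complex.mem_slitPlane_iff.2 (Or.inr (ratio_im_pos h h0).ne')
  have hne' : ∀ t ∈ Icc (0 : ℝ) 1, w + t * (w' - w) - z ≠ 0 := fun t ht h0 =>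
    Complex.slitPlane_ne_zero (hslit t ht) (by rw [h0, zero_div])
  have hd : ∀ t ∈ uIcc (0 : ℝ) 1,
      HasDerivAt (fun t : ℝ => Complex.log ((w + t * (w' - w) - z) / (w - z)))
        (1 / (w + t * (w' - w) - z) * (w' - w)) t := fun t ht => by
    rw [uIcc_of_le zero_le_one] at ht
    have h4 : HasDerivAt (fun t : ℝ => (t : ℂ)) 1 t := Complex.ofRealCLM.hasDerivAt
    have h5 := (((h4.mul_const (w' - w)).const_add w).sub_const z).div_const (w - z)
    convert h5.clog_real (hslit t ht) using 1
    have := hne' t ht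
    field_simp
  rw [segmentIntegral, intervalIntegral.integral_eq_sub_of_hasDerivAt hd
    (ContinuousOn.intervalIntegrable_of_Icc zero_le_one
      ((continuousOn_const.div (by fun_prop) hne').mul continuousOn_const))]
  simp [div_self hne]

theorem segmentIntegral_mul_const (g : ℂ → ℂ) (c w w' : ℂ) :
    segmentIntegral (fun ζ => c * g ζ) w w' = c * segmentIntegral g w w' := by
  rw [segmentIntegral, segmentIntegral, ← intervalIntegral.integral_const_mul]
  simp only [mul_assoc]

namespace IsConvexPolygon

variable {k : ℕ} [NeZero k] {ω : Fin k → ℂ}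

/-- The winding integral of a convex polygon is a nonzero constant in the interior. -/
theorem exists_sum_segmentIntegral_inv_eq (hω : IsConvexPolygon ω) :
    ∃ c : ℂ, c ≠ 0 ∧ ∀ z ∈ interior (polygonRegion ω),
      ∑ i, segmentIntegral (fun ζ => 1 / (ζ - z)) (ω i) (ω (i + 1)) = c := by
  have hpos := fun i z (hz : z ∈ interior (polygonRegion ω)) => hω.cross_pos_of_mem_interior i hz
  have him : ∀ i, ∀ z ∈ interior (polygonRegion ω), 0 < ((ω (i + 1) - z) / (ω i - z)).im :=
    fun i z hz => by simpa using ratio_im_pos (hpos i z hz) one_pos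
  have hne : ∀ i, ∀ z ∈ interior (polygonRegion ω), ω i - z ≠ 0 := fun i z hz h => by
    have := him i z hz
    simp [h] at this
  set J : ℂ → ℂ := fun z => ∑ i, Complex.log ((ω (i + 1) - z) / (ω i - z)) with hJ
  have hd : ∀ z ∈ interior (polygonRegion ω), HasDerivAt J 0 z := fun z hz => by
    have h1 : ∀ i, HasDerivAt (fun z => Complex.log ((ω (i + 1) - z) / (ω i - z)))
        (-((ω (i + 1) - z)⁻¹ - (ω i - z)⁻¹)) z := fun i => by
      have h2 : HasDerivAt (fun z => (ω (i + 1) - z) / (ω i - z))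
          (((-1) * (ω i - z) - (ω (i + 1) - z) * (-1)) / (ω i - z) ^ 2) z :=
        ((hasDerivAt_id z).const_sub (ω (i + 1))).div
          ((hasDerivAt_id z).const_sub (ω i)) (hne i z hz)
      convert h2.clog (Complex.mem_slitPlane_iff.2 (Or.inr (him i z hz).ne')) using 1
      have h3 := hne i z hz
      have h4 := hne (i + 1) z hz
      field_simp
      ring
    -- The derivatives telescope around the polygon, so the sum of logarithms is locally constant.
    have h5 := HasDerivAt.fun_sum (u := Finset.univ) fun i _ => h1 i
    rw [Finset.sum_neg_distrib, sum_sub_add_one_eq_zero (fun i => (ω i - z)⁻¹), neg_zero] at h5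
    exact h5
  obtain ⟨c, hc⟩ := isOpen_interior.exists_is_const_of_deriv_eq_zero
    (convex_polygonRegion ω).interior.isPreconnected
    (fun z hz => (hd z hz).differentiableAt.differentiableWithinAt) (fun z hz => (hd z hz).deriv)
  have hJc : ∀ z ∈ interior (polygonRegion ω),
      ∑ i, segmentIntegral (fun ζ => 1 / (ζ - z)) (ω i) (ω (i + 1)) = c := fun z hz => by
    rw [← hc z hz]
    exact Finset.sum_congr rfl fun i _ => segmentIntegral_inv_sub (hpos i z hz)
  refine ⟨c, ?_, hJc⟩
  obtain ⟨z, hz⟩ := hω.interior_nonempty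
  rintro rfl
  have h0 := congrArg Complex.im (hc z hz)
  simp only [hJ, Complex.im_sum, Complex.log_im, Complex.zero_im] at h0
  -- Every argument is positive, so their sum is nonzero; the exact value of the winding integral is
  -- not needed.
  have harg : ∀ i, 0 < Complex.arg ((ω (i + 1) - z) / (ω i - z)) := fun i => by
    refine lt_of_le_of_ne (Complex.arg_nonneg_iff.2 (him i z hz).le) fun h => ?_
    exact (him i z hz).ne' (Complex.arg_eq_zero_iff.1 h.symm).2
  exact (Finset.sum_pos (fun i _ => harg i) ⟨0, Finset.mem_univ 0⟩).ne' h0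

theorem segment_ne_of_mem_interior (hω : IsConvexPolygon ω) (i : Fin k) {z : ℂ}
    (hz : z ∈ interior (polygonRegion ω)) (t : ℝ) : ω i + t * (ω (i + 1) - ω i) ≠ z := by
  rintro rfl
  have := hω.cross_pos_of_mem_interior i hz
  rw [add_sub_cancel_left, cross_mul_self] at this
  simp at this

/-- Cauchy's integral formula for a convex polygon. -/
theorem sum_segmentIntegral_div_sub (hω : IsConvexPolygon ω) {f : ℂ → ℂ}
    (hc : ContinuousOn f (polygonRegion ω))
    (hd : DifferentiableOn ℂ f (interior (polygonRegion ω))) {z : ℂ}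
    (hz : z ∈ interior (polygonRegion ω)) :
    ∑ i, segmentIntegral (fun ζ => f ζ / (ζ - z)) (ω i) (ω (i + 1)) =
      f z * ∑ i, segmentIntegral (fun ζ => 1 / (ζ - z)) (ω i) (ω (i + 1)) := by
  have hzn := isOpen_interior.mem_nhds hz
  -- The difference quotient of `f` at `z`, with its removable singularity filled in, has a
  -- primitive and so integrates to zero around the polygon.
  obtain ⟨H, hH⟩ := exists_segmentIntegral_eq_sub (convex_polygonRegion ω) hω.interior_nonempty
    (h := dslope f z)
    ((continuousOn_dslope (mem_interior_iff_mem_nhds.1 hz)).2 ⟨hc, hd.differentiableAt hzn⟩)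
    ((Complex.differentiableOn_dslope hzn).2 hd)
  have h1 : ∑ i, segmentIntegral (dslope f z) (ω i) (ω (i + 1)) = 0 := by
    rw [← sum_sub_add_one_eq_zero (fun i => H (ω i))]
    exact Finset.sum_congr rfl fun i _ =>
      hH _ (mem_polygonRegion ω i) _ (mem_polygonRegion ω (i + 1))
  rw [← sub_eq_zero, ← h1, Finset.mul_sum, ← Finset.sum_sub_distrib]
  refine Finset.sum_congr rfl fun i _ => ?_
  have hne : ∀ t : ℝ, ω i + t * (ω (i + 1) - ω i) - z ≠ 0 := fun t =>
    _root_.sub_ne_zero.2 (hω.segment_ne_of_mem_interior i hz t)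
  rw [← segmentIntegral_mul_const, segmentIntegral, segmentIntegral, segmentIntegral,
    ← intervalIntegral.integral_sub]
  · refine intervalIntegral.integral_congr fun t _ => ?_
    rw [dslope_of_ne _ (hω.segment_ne_of_mem_interior i hz t), slope_def_field]
    ring
  · refine ContinuousOn.intervalIntegrable_of_Icc zero_le_one
      (ContinuousOn.mul (ContinuousOn.div (hc.comp (by fun_prop) fun t ht => ?_) (by fun_prop)
        fun t _ => hne t) continuousOn_const)
    exact add_mul_sub_mem (convex_polygonRegion ω) (mem_polygonRegion ω i)
      (mem_polygonRegion ω (i + 1)) ht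
  · exact ContinuousOn.intervalIntegrable_of_Icc zero_le_one
      (ContinuousOn.mul (continuousOn_const.mul (continuousOn_const.div (by fun_prop)
        fun t _ => hne t)) continuousOn_const)

end IsConvexPolygon

/-! ### Assembly over the sides and reduction to vanishing corner values -/

namespace IsConvexPolygon

variable {k : ℕ} [NeZero k] {ω : Fin k → ℂ} {f g : ℂ → ℂ} {δ R : ℝ} {i : Fin k}

theorem exists_bound_of_isBigO (hR : 0 < R)
    (hO : g =O[𝓝[slitDisc ω i R] (ω i)] fun z => ‖z - ω i‖ ^ δ) :
    ∃ R' : ℝ, 0 < R' ∧ R' ≤ R ∧ ∃ M : ℝ, ∀ z ∈ slitDisc ω i R', ‖g z‖ ≤ M * ‖z - ω i‖ ^ δ := by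
  obtain ⟨M, hM⟩ := hO.bound
  obtain ⟨ε, hε, h⟩ := Metric.mem_nhdsWithin_iff.1 hM
  refine ⟨min R ε, lt_min hR hε, min_le_left _ _, M, fun z hz => ?_⟩
  have h1 := h ⟨Metric.ball_subset_ball (min_le_right _ _) hz.1,
    Metric.ball_subset_ball (min_le_left _ _) hz.1, hz.2⟩
  rwa [mem_ofPred_eq, Real.norm_of_nonneg (Real.rpow_nonneg (norm_nonneg _) _)] at h1

theorem extendsAtCorner {e : ℂ} (he : e = ω (i + 1) - ω i ∨ e = ω (i - 1) - ω i) (hR : 0 < R)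
    (hg : AnalyticOnNhd ℂ g (slitDisc ω i R)) (hgf : EqOn g f (polygonRegion ω ∩ slitDisc ω i R))
    (hO : g =O[𝓝[slitDisc ω i R] (ω i)] fun z => ‖z - ω i‖ ^ δ) :
    ExtendsAtCorner (polygonRegion ω) f δ (ω i) e := by
  obtain ⟨R', hR', hRR', M, hM⟩ := exists_bound_of_isBigO hR hO
  have hsub : halfBall (ω i) e R' ⊆ slitDisc ω i R' := fun z hz =>
    ⟨hz.1, not_mem_exteriorBisector_of_re_pos he hz.2⟩
  have hsub' : halfBall (ω i) e R' ⊆ slitDisc ω i R := hsub.trans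
    (sdiff_subset_sdiff_left (Metric.ball_subset_ball hRR'))
  exact ⟨R', hR', M, g, hg.mono hsub', hgf.mono (inter_subset_inter_right _ hsub'),
    fun z hz => hM z (hsub hz)⟩

theorem continuousWithinAt_corner (hω : IsConvexPolygon ω) (hδ : 0 < δ) (hR : 0 < R)
    (hgf : EqOn g f (polygonRegion ω ∩ slitDisc ω i R))
    (hO : g =O[𝓝[slitDisc ω i R] (ω i)] fun z => ‖z - ω i‖ ^ δ) (hf : f (ω i) = 0) :
    ContinuousWithinAt f (polygonRegion ω) (ω i) := by
  obtain ⟨R', hR', hRR', M, hM⟩ := exists_bound_of_isBigO hR hO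
  rw [ContinuousWithinAt, hf]
  have hev : ∀ᶠ z in 𝓝[polygonRegion ω] (ω i), ‖f z‖ ≤ M * ‖z - ω i‖ ^ δ := by
    filter_upwards [self_mem_nhdsWithin, nhdsWithin_le_nhds (Metric.ball_mem_nhds _ hR')]
      with z hz hzR
    by_cases hzi : z = ω i
    · simp [hzi, hf, Real.zero_rpow hδ.ne']
    · have hzs : z ∈ slitDisc ω i R' := ⟨hzR, fun h => hzi (hω.eq_of_mem_exteriorBisector hz h)⟩
      rw [← hgf ⟨hz, Metric.ball_subset_ball hRR' hzs.1, hzs.2⟩]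
      exact hM z hzs
  refine squeeze_zero_norm' hev ?_
  have h2 : Continuous fun z : ℂ => M * ‖z - ω i‖ ^ δ :=
    continuous_const.mul ((by fun_prop : Continuous fun z : ℂ => ‖z - ω i‖).rpow_const
      fun _ => Or.inr hδ.le)
  have h3 := (h2.tendsto (ω i)).mono_left (nhdsWithin_le_nhds (s := polygonRegion ω))
  simpa [Real.zero_rpow hδ.ne'] using h3

theorem continuousOn_and_hasRootExpApprox_of_eq_zero (hω : IsConvexPolygon ω) (hδ : 0 < δ)
    (hint : AnalyticOnNhd ℂ f (interior (polygonRegion ω)))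
    (hside : ∀ i, ∀ z ∈ openSide ω i, AnalyticWithinAt ℂ f (polygonRegion ω) z)
    (hcorner : ∀ i, ∃ R : ℝ, 0 < R ∧ ∃ g : ℂ → ℂ,
      AnalyticOnNhd ℂ g (slitDisc ω i R) ∧
      EqOn g f (polygonRegion ω ∩ slitDisc ω i R) ∧
      g =O[𝓝[slitDisc ω i R] (ω i)] (fun z => ‖z - ω i‖ ^ δ))
    (hf : ∀ i, f (ω i) = 0) :
    ContinuousOn f (polygonRegion ω) ∧ HasRootExpApprox (polygonRegion ω) f := by
  choose R hR g hg hgf hO using hcorner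
  have hcont : ContinuousOn f (polygonRegion ω) := by
    intro z hz
    rcases hω.mem_interior_or hz with h | ⟨i, h⟩ | ⟨i, rfl⟩
    · exact (hint z h).continuousAt.continuousWithinAt
    · exact (hside i z h).continuousWithinAt
    · exact hω.continuousWithinAt_corner hδ (hR i) (hgf i) (hO i) (hf i)
  refine ⟨hcont, ?_⟩
  obtain ⟨c, hc0, hc⟩ := hω.exists_sum_segmentIntegral_inv_eq
  have hseg : ∀ i, ∀ s ∈ Ioo (0 : ℝ) 1, ω i + s * (ω (i + 1) - ω i) ∈ openSide ω i :=
    fun i s hs => by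
      rw [openSide, openSegment_eq_image']
      exact ⟨s, hs, by simp⟩
  have happ : ∀ i, HasRootExpApprox (polygonRegion ω)
      (fun z => segmentIntegral (fun ζ => f ζ / (ζ - z)) (ω i) (ω (i + 1))) := fun i => by
    have hadd : ω i + (ω (i + 1) - ω i) = ω (i + 1) := add_sub_cancel _ _
    have hcor := extendsAtCorner (i := i) (Or.inl rfl) (hR i) (hg i) (hgf i) (hO i)
    have hcor' := extendsAtCorner (i := i + 1) (e := -(ω (i + 1) - ω i))
      (Or.inr (by rw [add_sub_cancel_right, neg_sub])) (hR _) (hg _) (hgf _) (hO _)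
    have h := hasRootExpApprox_cauchyIntegral_segment (f := f) (p := ω i)
      (D := ω (i + 1) - ω i) hω.closure_interior.ge (hω.sub_ne_zero i)
      (fun s hs => hside i _ (hseg i s hs))
      (fun s hs => add_mul_sub_mem (convex_polygonRegion ω) (mem_polygonRegion ω i)
        (mem_polygonRegion ω (i + 1)) ⟨hs.1.le, hs.2.le⟩) hδ hcor
      (by rwa [hadd]) (hf i) (by rw [hadd]; exact hf _) (hω.subset_halfPlane i)
      (by rw [hadd]; exact hω.subset_halfPlane' i)
    rwa [hadd] at h
  refine ((HasRootExpApprox.sum Finset.univ _ fun i _ => happ i).const_mul c⁻¹).congr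
    fun z hz => ?_
  simp only
  rw [hω.sum_segmentIntegral_div_sub hcont hint.differentiableOn hz, hc z hz]
  field_simp

theorem continuousOn_and_hasRootExpApprox (hω : IsConvexPolygon ω) (hδ : 0 < δ)
    (hint : AnalyticOnNhd ℂ f (interior (polygonRegion ω)))
    (hside : ∀ i, ∀ z ∈ openSide ω i, AnalyticWithinAt ℂ f (polygonRegion ω) z)
    (hcorner : ∀ i, ∃ R : ℝ, 0 < R ∧ ∃ g : ℂ → ℂ,
      AnalyticOnNhd ℂ g (slitDisc ω i R) ∧
      EqOn g f (polygonRegion ω ∩ slitDisc ω i R) ∧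
      (fun z => g z - f (ω i)) =O[𝓝[slitDisc ω i R] (ω i)] (fun z => ‖z - ω i‖ ^ δ)) :
    ContinuousOn f (polygonRegion ω) ∧ HasRootExpApprox (polygonRegion ω) f := by
  set P := Lagrange.interpolate Finset.univ ω fun i => f (ω i) with hP
  have hPω : ∀ i, P.eval (ω i) = f (ω i) := fun i =>
    Lagrange.eval_interpolate_at_node _ hω.injective.injOn (Finset.mem_univ i)
  have hPan : ∀ z, AnalyticAt ℂ (fun z => P.eval z) z := fun z =>
    P.differentiable.analyticAt z
  -- The polynomial is only known to satisfy `P z - P (ω i) = O(|z - ω i|)`, so the exponent is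
  -- lowered to `min δ 1`.
  obtain ⟨hc, ha⟩ := hω.continuousOn_and_hasRootExpApprox_of_eq_zero
    (f := fun z => f z - P.eval z) (δ := min δ 1) (lt_min hδ one_pos)
    (fun z hz => (hint z hz).sub (hPan z))
    (fun i z hz => (hside i z hz).sub (hPan z).analyticWithinAt)
    (fun i => by
      obtain ⟨R, hR, g, hg, hgf, hO⟩ := hcorner i
      refine ⟨R, hR, fun z => g z - P.eval z, fun z hz => (hg z hz).sub (hPan z),
        fun z hz => by simp only [hgf hz], ?_⟩
      have hev : ∀ᶠ z in 𝓝 (ω i), ‖z - ω i‖ ≤ 1 := by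
        filter_upwards [Metric.ball_mem_nhds (ω i) one_pos] with z hz
        rw [← dist_eq_norm]
        exact (Metric.mem_ball.1 hz).le
      have hpow : ∀ s, min δ 1 ≤ s →
          (fun z => ‖z - ω i‖ ^ s) =O[𝓝 (ω i)] fun z => ‖z - ω i‖ ^ min δ 1 := fun s hs => by
        refine IsBigO.of_bound 1 (hev.mono fun z hz => ?_)
        rw [one_mul, Real.norm_of_nonneg (Real.rpow_nonneg (norm_nonneg _) _),
          Real.norm_of_nonneg (Real.rpow_nonneg (norm_nonneg _) _)]
        exact Real.rpow_le_rpow_of_exponent_ge_of_imp (norm_nonneg _) hz hs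
          fun _ h => absurd h ((lt_min hδ one_pos).trans_le hs).ne'
      have h1 := hO.trans ((hpow δ (min_le_left _ _)).mono nhdsWithin_le_nhds)
      have h2 : (fun z => P.eval z - f (ω i)) =O[𝓝 (ω i)] fun z => ‖z - ω i‖ ^ min δ 1 := by
        have h3 := (hPan (ω i)).differentiableAt.isBigO_sub
        simp only [hPω] at h3
        refine h3.norm_right.trans ?_
        simpa using hpow 1 (min_le_right _ _)
      simpa using h1.sub (h2.mono nhdsWithin_le_nhds))
    (fun i => by simp [hPω])
  constructor
  · have := hc.add (P.continuous.continuousOn (s := polygonRegion ω))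
    refine this.congr fun z _ => ?_
    simp
  · refine (ha.add (HasRootExpApprox.polynomial _ P)).congr fun z _ => ?_
    simp

end IsConvexPolygon

/-! ### From degree `O(n)` to degree at most `n`, and supremum norms -/

theorem supNorm_le_ofReal {S : Set ℂ} {g : ℂ → ℂ} {b : ℝ} (h : ∀ z ∈ S, ‖g z‖ ≤ b) :
    supNorm S g ≤ ENNReal.ofReal b :=
  iSup₂_le fun z hz => by
    rw [← ofReal_norm]
    exact ENNReal.ofReal_le_ofReal (h z hz)

theorem IsRationalOn.continuousOn {n : ℕ} {S : Set ℂ} {r : ℂ → ℂ} (hr : IsRationalOn n S r) :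
    ContinuousOn r S := by
  obtain ⟨p, q, -, -, h⟩ := hr
  exact (p.continuous.continuousOn.div q.continuous.continuousOn fun z hz => (h z hz).1).congr
    fun z hz => (h z hz).2

/-- Passage from degree `O(n)` on the interior to degree at most `n` on the closed set. -/
theorem HasRootExpApprox.exists_isRationalOn {K : Set ℂ} (hK : IsCompact K)
    (hKi : closure (interior K) = K) {f : ℂ → ℂ} (hc : ContinuousOn f K)
    (hf : HasRootExpApprox K f) :
    ∃ r : ℕ → ℂ → ℂ, (∀ n, IsRationalOn n K (r n)) ∧
      (∃ C : ℝ, 0 < C ∧ ∃ M : ℝ, ∀ n : ℕ, ∀ z ∈ K, ‖f z - r n z‖ ≤ M * Real.exp (-C * √n)) ∧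
      ∀ E : Set ℂ, IsCompact E → E ⊆ interior K → ∃ c : ℝ, 0 < c ∧ ∃ M : ℝ, ∀ᶠ n : ℕ in atTop,
        ∀ z ∈ E, ‖f z - r n z‖ ≤ M * Real.exp (-c * n) := by
  obtain ⟨d, r, hr, ⟨C, hC, M, hM⟩, hE⟩ := hf
  have hMK : ∀ n : ℕ, ∀ z ∈ K, ‖f z - r n z‖ ≤ M * Real.exp (-C * √n) := fun n z hz => by
    have hcont : ContinuousOn (fun z => ‖f z - r n z‖) K := (hc.sub (hr n).continuousOn).norm
    rw [← hKi] at hcont hz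
    exact le_on_closure (hM n) hcont continuousOn_const hz
  obtain ⟨B, hB⟩ := hK.exists_bound_of_continuousOn hc
  -- Adding one keeps the divisor positive when `d = 0`. For `n ≥ D` the index `n / D - 1` has
  -- degree at most `d * (n / D) ≤ n`; the finitely many smaller `n` use the zero function, at the
  -- cost of a constant.
  set D := d + 1 with hD
  have hD0 : (0 : ℝ) < D := by positivity
  have hsD : 0 < √(D : ℝ) := Real.sqrt_pos.2 hD0
  have hdiv : ∀ n, D ≤ n → (n : ℝ) ≤ D * ((n / D - 1 : ℕ) + 2) := fun n hn => by
    have h1 : n / D - 1 + 2 = n / D + 1 := by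
      have := Nat.div_pos hn (by omega)
      omega
    have h2 := (Nat.lt_mul_div_succ n (show 0 < D by omega)).le
    have h3 : n ≤ D * (n / D - 1 + 2) := by rw [h1]; exact h2
    exact_mod_cast h3
  refine ⟨fun n => if n < D then 0 else r (n / D - 1), fun n => ?_,
    ⟨C / √D, by positivity, |M| * Real.exp (2 * C) + |B| * Real.exp C, fun n z hz => ?_⟩,
    fun E h1 h2 => ?_⟩
  · by_cases h : n < D
    · simpa [h] using! isRationalOn_polynomial n K 0 (by simp)
    · simp only [h, if_false]
      refine (hr _).mono ?_
      have h1 : n / D - 1 + 1 = n / D := by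
        have := Nat.div_pos (not_lt.1 h) (by omega)
        omega
      rw [h1]
      exact (Nat.mul_le_mul_right _ (by omega)).trans (Nat.mul_div_le n D)
  · rw [add_mul]
    by_cases h : n < D
    · simp only [h, if_true, Pi.zero_apply, sub_zero]
      refine ((hB z hz).trans (le_abs_self B)).trans ?_
      refine le_add_of_nonneg_of_le (by positivity) ?_
      rw [mul_assoc, ← Real.exp_add]
      refine le_mul_of_one_le_right (abs_nonneg B) (Real.one_le_exp ?_)
      have h1 : √(n : ℝ) ≤ √(D : ℝ) := Real.sqrt_le_sqrt (by exact_mod_cast h.le)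
      have h2 : C / √D * √n ≤ C := by
        rw [div_mul_eq_mul_div, div_le_iff₀ hsD]
        gcongr
      linarith
    · simp only [h, if_false]
      refine le_add_of_le_of_nonneg ?_ (by positivity)
      refine (hMK _ z hz).trans ((mul_le_mul_of_nonneg_right (le_abs_self M)
        (Real.exp_pos _).le).trans ?_)
      rw [mul_assoc, ← Real.exp_add]
      refine mul_le_mul_of_nonneg_left (Real.exp_le_exp.2 ?_) (abs_nonneg M)
      set m := n / D - 1
      -- From `n ≤ D (m + 2)` and `√(m + 2) ≤ √m + 2`; the additive loss goes into the factor `exp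
      -- (2 C)`.
      have h1 : √(n : ℝ) ≤ √D * (√m + 2) := by
        rw [Real.sqrt_le_left (by positivity), mul_pow, Real.sq_sqrt hD0.le]
        refine (hdiv n (not_lt.1 h)).trans (mul_le_mul_of_nonneg_left ?_ hD0.le)
        nlinarith [Real.sq_sqrt (Nat.cast_nonneg (α := ℝ) m), Real.sqrt_nonneg (m : ℝ)]
      have h2 : C / √D * √n ≤ C * (√m + 2) := by
        rw [div_mul_eq_mul_div, div_le_iff₀ hsD]
        calc C * √n ≤ C * (√D * (√m + 2)) := by gcongr
          _ = C * (√m + 2) * √D := by ring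
      linarith
  · obtain ⟨c, hc0, M', hM'⟩ := hE E h1 h2
    refine ⟨c / D, by positivity, |M'| * Real.exp (2 * c), ?_⟩
    filter_upwards [eventually_ge_atTop D] with n hn z hz
    simp only [not_lt.2 hn, if_false]
    refine (hM' _ z hz).trans ((mul_le_mul_of_nonneg_right (le_abs_self M')
      (Real.exp_pos _).le).trans ?_)
    rw [mul_assoc, ← Real.exp_add]
    refine mul_le_mul_of_nonneg_left (Real.exp_le_exp.2 ?_) (abs_nonneg M')
    have h3 : c / D * n ≤ c * ((n / D - 1 : ℕ) + 2) := by
      rw [div_mul_eq_mul_div, div_le_iff₀ hD0]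
      calc c * n ≤ c * (D * ((n / D - 1 : ℕ) + 2)) := by
            gcongr
            exact hdiv n hn
        _ = c * ((n / D - 1 : ℕ) + 2) * D := by ring
    linarith

/-- Weighting with half the rate leaves a factor `exp (-(c / 2) n)`, which tends to zero. -/
theorem limsup_supNorm_mul_exp_eq_zero {E : Set ℂ} {g : ℕ → ℂ → ℂ} {c M : ℝ} (hc : 0 < c)
    (h : ∀ᶠ n : ℕ in atTop, ∀ z ∈ E, ‖g n z‖ ≤ M * Real.exp (-c * n)) :
    limsup (fun n : ℕ => supNorm E (g n) * ENNReal.ofReal (Real.exp (c / 2 * n))) atTop = 0 := by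
  have hlim : Tendsto (fun n : ℕ => ENNReal.ofReal (M * Real.exp (-(c / 2 * n)))) atTop (𝓝 0) := by
    have h1 : Tendsto (fun n : ℕ => M * Real.exp (-(c / 2 * n))) atTop (𝓝 (M * 0)) :=
      (Real.tendsto_exp_neg_atTop_nhds_zero.comp
        (tendsto_natCast_atTop_atTop.const_mul_atTop (half_pos hc))).const_mul M
    simpa using ENNReal.tendsto_ofReal h1
  refine (tendsto_of_tendsto_of_tendsto_of_le_of_le' tendsto_const_nhds hlim
    (Eventually.of_forall fun _ => zero_le) (h.mono fun n hn => ?_)).limsup_eq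
  refine (mul_le_mul_left (supNorm_le_ofReal hn) _).trans ?_
  rw [← ENNReal.ofReal_mul' (Real.exp_pos _).le, mul_assoc, ← Real.exp_add]
  refine le_of_eq ?_
  congr 3
  ring

end

theorem theorem3 {k : ℕ} [NeZero k] (ω : Fin k → ℂ) (hω : IsConvexPolygon ω)
    (f : ℂ → ℂ) (δ : ℝ) (hδ : 0 < δ)
    (hint : AnalyticOnNhd ℂ f (interior (polygonRegion ω)))
    (hside : ∀ i, ∀ z ∈ openSide ω i, AnalyticWithinAt ℂ f (polygonRegion ω) z)
    (hcorner : ∀ i, ∃ R : ℝ, 0 < R ∧ ∃ g : ℂ → ℂ,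
      AnalyticOnNhd ℂ g (slitDisc ω i R) ∧
      EqOn g f (polygonRegion ω ∩ slitDisc ω i R) ∧
      (fun z => g z - f (ω i)) =O[𝓝[slitDisc ω i R] (ω i)] (fun z => ‖z - ω i‖ ^ δ)) :
    ∃ r : ℕ → ℂ → ℂ,
      (∀ n : ℕ, 1 ≤ n → IsRationalOn n (polygonRegion ω) (r n)) ∧
      (∃ C : ℝ, 0 < C ∧ ∃ M : ℝ, ∀ n : ℕ, 1 ≤ n →
        supNorm (polygonRegion ω) (fun z => f z - r n z)
          ≤ ENNReal.ofReal (M * Real.exp (-C * Real.sqrt n))) ∧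
      (∀ E : Set ℂ, IsCompact E → E ⊆ interior (polygonRegion ω) →
        ∃ c : ℝ, 0 < c ∧
          limsup (fun n : ℕ =>
            supNorm E (fun z => f z - r n z) * ENNReal.ofReal (Real.exp (c * n))) atTop = 0) := by
  obtain ⟨hcont, happ⟩ := hω.continuousOn_and_hasRootExpApprox hδ hint hside hcorner
  obtain ⟨r, hr, ⟨C, hC, M, hM⟩, hE⟩ :=
    happ.exists_isRationalOn (isCompact_polygonRegion ω) hω.closure_interior hcont
  refine ⟨r, fun n _ => hr n, ⟨C, hC, M, fun n _ => supNorm_le_ofReal (hM n)⟩, fun E h1 h2 => ?_⟩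
  obtain ⟨c, hc, B, hB⟩ := hE E h1 h2
  exact ⟨c / 2, half_pos hc, limsup_supNorm_mul_exp_eq_zero hc hB⟩
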